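/- Let $G=(V,E)$ be a finite, connected, simple graph embedded in the plane. Group of the graph. Let $M_G$ be the group generated by the phases $\{\pm1,\pm i\}$ (central, multiplying as usual), the vertices $v_j\in V$ and the directed edges $e_{ij}$ ($\{i,j\}\in E$), subject to: $e_{ij}^2=v_j^2=1$; $e_{ij}=-e_{ji}$; vertices commute with each other; $e_{ij}$ commutes with $v_k$ for $k\ne i,j$ and anticommutes with $v_j$; edges without a common vertex commute; and $e_{ij}e_{jk}=-e_{jk}e_{ij}$ for $k\neq i$. For a closed walk with $n$ directed edges $e_1,\dots,e_n$ consider the element $i^{\,n}e_1e_2\cdots e_n$ of $M_G$; these elements form the cycle group $\mathcal C_G\le M_G$. The *face cycle* of a bounded face is the element of $\mathcal C_G$ given by its boundary walk, and the *number of sides* of the face is the length of that walk. Encoding. A *fermionic encoding* is a representation $\sigma$ of $M_G$ on a system of qubits that takes values in the multi-qubit Pauli group, maps each phase to itself, and maps no element of $\mathcal C_G$ to $-1$. It is a *Weight 3 planar encoding* if: the qubits are one vertex qubit for each vertex, together with auxiliary qubits, each associated with one bounded face, at most one per face; $\sigma(v_j)$ is $Z$ on the qubit of $v_j$; and each $\sigma(e_{ij})$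 is, up to a phase, the product of an $X$ or $Y$ on each of the vertex qubits of $i$ and $j$ and of a Pauli $X$, $Y$ or $Z$ on at most one auxiliary qubit, belonging to a face adjacent to the edge $\{i,j\}$. Put $K:=\ker(\sigma|_{\mathcal C_G})$. Theorem. Let $\sigma$ be a Weight 3 planar encoding of $G$ such that every bounded face that carries an auxiliary qubit is bounded by a simple cycle of $G$ (its boundary walk repeats no vertex). Then $K$ is minimally generated by the face cycles (of bounded faces) that it contains: they generate $K$, no proper subset of them generates $K$, and no generating set of $K$ has fewer elements. Moreover, every bounded face whose face cycle lies in $K$ has 3 or 4 sides. -/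

import Mathlib

/-! ### Multi-qubit Pauli operators -/

/-- The labels of the four single-qubit Pauli operators. -/
inductive Pauli
  | I
  | X
  | Y
  | Z

/-- The `2 × 2` matrix of a single-qubit Pauli operator. -/
noncomputable def Pauli.toMatrix : Pauli → Matrix (Fin 2) (Fin 2) ℂ
  | Pauli.I => !![1, 0; 0, 1]
  | Pauli.X => !![0, 1; 1, 0]
  | Pauli.Y => !![0, -Complex.I; Complex.I, 0]
  | Pauli.Z => !![1, 0; 0, -1]

/-- Operators on the Hilbert space `(ℂ²)^{⊗ Q}` of qubits labelled by `Q`, as matrices in the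
computational basis `Q → Fin 2`. -/
abbrev QubitOp (Q : Type*) := Matrix (Q → Fin 2) (Q → Fin 2) ℂ

/-- The tensor product `⨂_q P q` of single-qubit Pauli operators. -/
noncomputable def pauliString {Q : Type*} [Fintype Q] (P : Q → Pauli) : QubitOp Q :=
  fun s t => ∏ q, (P q).toMatrix (s q) (t q)

/-- Membership in the multi-qubit Pauli group `{±1, ±i} × {I, X, Y, Z}^Q`. -/
def IsPauliOp {Q : Type*} [Fintype Q] (M : QubitOp Q) : Prop :=
  ∃ (k : ℕ) (P : Q → Pauli), M = Complex.I ^ k • pauliString P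

/-! ### The group of edge and vertex operators of a graph -/

/-- Generators of `M_G`: the phases `i ^ k`, the vertices and the directed edges of `G`. -/
inductive EVGen {V : Type*} (G : SimpleGraph V)
  | phase (k : ZMod 4)
  | vertex (v : V)
  | edge (d : G.Dart)

namespace EVGen

variable {V : Type*} (G : SimpleGraph V)

/-- The phase `i ^ k` as a word. -/
def ph (k : ZMod 4) : FreeGroup (EVGen G) := FreeGroup.of (EVGen.phase k)

/-- A vertex generator as a word. -/
def ve (v : V) : FreeGroup (EVGen G) := FreeGroup.of (EVGen.vertex v)

/-- A directed edge generator as a word. -/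
def ed (d : G.Dart) : FreeGroup (EVGen G) := FreeGroup.of (EVGen.edge d)

/-- The defining relations of `M_G`, as pairs of words to be identified.  The phases
`1, i, -1, -i` are `ph 0, ph 1, ph 2, ph 3`. -/
inductive Rel : FreeGroup (EVGen G) → FreeGroup (EVGen G) → Prop
  | phase_mul (k l : ZMod 4) : Rel (ph G k * ph G l) (ph G (k + l))
  | phase_central (k : ZMod 4) (g : EVGen G) :
      Rel (ph G k * FreeGroup.of g) (FreeGroup.of g * ph G k)
  | edge_sq (d : G.Dart) : Rel (ed G d * ed G d) 1
  | vertex_sq (v : V) : Rel (ve G v * ve G v) 1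
  | edge_symm (d : G.Dart) : Rel (ed G d) (ph G 2 * ed G d.symm)
  | vertex_comm (v w : V) : v ≠ w → Rel (ve G v * ve G w) (ve G w * ve G v)
  | edge_vertex_comm (d : G.Dart) (v : V) : v ≠ d.fst → v ≠ d.snd →
      Rel (ed G d * ve G v) (ve G v * ed G d)
  | edge_edge_comm (d d' : G.Dart) : d.fst ≠ d'.fst → d.fst ≠ d'.snd → d.snd ≠ d'.fst →
      d.snd ≠ d'.snd → Rel (ed G d * ed G d') (ed G d' * ed G d)
  | edge_vertex_anticomm (d : G.Dart) :
      Rel (ed G d * ve G d.snd) (ph G 2 * (ve G d.snd * ed G d))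
  | edge_edge_anticomm (d d' : G.Dart) : d.snd = d'.fst → d.fst ≠ d'.snd →
      Rel (ed G d * ed G d') (ph G 2 * (ed G d' * ed G d))

end EVGen

/-- The finitely presented group `M_G`. -/
abbrev EVGroup {V : Type*} (G : SimpleGraph V) :=
  PresentedGroup {r : FreeGroup (EVGen G) | ∃ x y, EVGen.Rel G x y ∧ r = x * y⁻¹}

namespace EVGroup

variable {V : Type*} (G : SimpleGraph V)

/-- The phase `i ^ k` in `M_G`. -/
def phase (k : ZMod 4) : EVGroup G := PresentedGroup.of (EVGen.phase k)

/-- The element of `M_G` given by a vertex. -/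
def vertex (v : V) : EVGroup G := PresentedGroup.of (EVGen.vertex v)

/-- The element `e_{ij}` of `M_G` given by a directed edge `(i, j)`. -/
def edge (d : G.Dart) : EVGroup G := PresentedGroup.of (EVGen.edge d)

/-- The element `i ^ n * e_1 * e_2 * ⋯ * e_n` given by a list of `n` directed edges. -/
def loopElement (l : List G.Dart) : EVGroup G :=
  phase G (l.length : ZMod 4) * (l.map (edge G)).prod

/-- The group `C_G` of directed cycles: the subgroup of `M_G` of the elements
`i ^ n * e_1 * ⋯ * e_n` given by the closed walks `e_1, …, e_n` of `G`.  (For connected `G` these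
elements already form a subgroup, so that taking the closure adds nothing.) -/
def cycleGroup : Subgroup (EVGroup G) :=
  Subgroup.closure {c | ∃ (u : V) (w : G.Walk u u), c = loopElement G w.darts}

end EVGroup

/-! ### Fermionic encodings -/

section Encoding

variable {V Q : Type*} [Fintype Q] [DecidableEq Q] {G : SimpleGraph V}

/-- A representation `σ` of `M_G` on qubits is a fermionic encoding if it takes values in the
Pauli group, represents the phases by themselves, and maps no directed cycle to `-1`. -/
structure IsFermionicEncoding (σ : EVGroup G →* QubitOp Q) : Prop where
  isPauliOp : ∀ m, IsPauliOp (σ m)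
  map_phase : ∀ k : ZMod 4, σ (EVGroup.phase G k) = Complex.I ^ k.val • (1 : QubitOp Q)
  map_cycle_ne : ∀ c ∈ EVGroup.cycleGroup G, σ c ≠ -1

/-- The kernel `K` of the restriction of `σ` to the group `C_G` of directed cycles. -/
def encodingKernel (σ : EVGroup G →* QubitOp Q) : Subgroup (EVGroup.cycleGroup G) :=
  (σ.comp (EVGroup.cycleGroup G).subtype).ker

end Encoding

/-! ### Plane graphs, as rotation systems of genus zero with a chosen outer face -/

/-- A rotation system: at every vertex, a cyclic order of the directed edges that leave it. -/
structure RotationSystem {V : Type*} (G : SimpleGraph V) where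
  /-- the next directed edge out of the same vertex -/
  rot : Equiv.Perm G.Dart
  rot_fst : ∀ d, (rot d).fst = d.fst
  rot_sameCycle : ∀ d d', d.fst = d'.fst → rot.SameCycle d d'

namespace RotationSystem

variable {V : Type*} {G : SimpleGraph V} (R : RotationSystem G)

/-- One step of the walk along the boundary of the face on a fixed side of a directed edge:
after `(u, v)`, leave `v` along the directed edge next to `(v, u)`. -/
def faceNext : Equiv.Perm G.Dart :=
  (Function.Involutive.toPerm SimpleGraph.Dart.symm SimpleGraph.Dart.symm_involutive).trans R.rot

/-- The faces: the orbits of `faceNext`.  An isolated vertex also has a face around it, which no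
directed edge bounds; in a connected graph this happens only if the graph is a single vertex. -/
def Face : Type _ :=
  Quotient (Equiv.Perm.SameCycle.setoid R.faceNext) ⊕ {v : V // ∀ w, ¬ G.Adj v w}

/-- The face whose boundary walk runs through the directed edge `d`. -/
def faceOf (d : G.Dart) : R.Face :=
  Sum.inl (Quotient.mk (Equiv.Perm.SameCycle.setoid R.faceNext) d)

/-- The edge of `d` is adjacent to the face `f`, i.e. `f` lies on one of its two sides. -/
def Adjacent (d : G.Dart) (f : R.Face) : Prop := R.faceOf d = f ∨ R.faceOf d.symm = f

/-- The number of sides of a face, i.e. the length of its boundary walk. -/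
noncomputable def sides (f : R.Face) : ℕ := Nat.card {d : G.Dart // R.faceOf d = f}

/-- The boundary walk of `f` visits no vertex twice. -/
def IsSimpleFace (f : R.Face) : Prop :=
  ∀ d d' : G.Dart, R.faceOf d = f → R.faceOf d' = f → d.fst = d'.fst → d = d'

/-- The boundary walk, started at the directed edge `d`, of the face `faceOf d`. -/
noncomputable def boundaryFrom (d : G.Dart) : List G.Dart :=
  List.iterate R.faceNext d (Function.minimalPeriod R.faceNext d)

/-- `c` is the face cycle of `f`, read from some starting point of its boundary walk. -/
def IsFaceCycle (f : R.Face) (c : EVGroup G) : Prop :=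
  ∃ d : G.Dart, R.faceOf d = f ∧ c = EVGroup.loopElement G (R.boundaryFrom d)

end RotationSystem

/-- A (combinatorial) embedding of a finite connected graph in the plane: a rotation system of
genus zero, by Euler's formula `|V| - |E| + |F| = 2`, with one face chosen as the unbounded one. -/
structure PlaneEmbedding {V : Type*} (G : SimpleGraph V) extends RotationSystem G where
  euler : Nat.card V + Nat.card toRotationSystem.Face = Nat.card G.edgeSet + 2
  /-- the unbounded face -/
  outer : toRotationSystem.Face

/-! ### Weight 3 planar encodings -/

/-- Weight 3 planar encodings.  The qubits are one vertex qubit for each element of `V` and the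
auxiliary qubits `A`; the auxiliary qubit `a` is associated with the bounded face `loc a`. -/
structure IsWeightThreePlanarEncoding {V A : Type*} [Fintype V] [DecidableEq V] [Fintype A]
    [DecidableEq A] {G : SimpleGraph V} (E : PlaneEmbedding G) (loc : A → E.Face)
    (σ : EVGroup G →* QubitOp (V ⊕ A)) : Prop extends IsFermionicEncoding σ where
  loc_bounded : ∀ a, loc a ≠ E.outer
  /-- every face has at most one auxiliary qubit -/
  loc_injective : Function.Injective loc
  vertex_op : ∀ v : V, σ (EVGroup.vertex G v) =
    pauliString (Function.update (fun _ => Pauli.I) (Sum.inl v) Pauli.Z)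
  edge_op : ∀ d : G.Dart, ∃ (k : ℕ) (P : V ⊕ A → Pauli),
    σ (EVGroup.edge G d) = Complex.I ^ k • pauliString P ∧
    (P (Sum.inl d.fst) = Pauli.X ∨ P (Sum.inl d.fst) = Pauli.Y) ∧
    (P (Sum.inl d.snd) = Pauli.X ∨ P (Sum.inl d.snd) = Pauli.Y) ∧
    (∀ v, v ≠ d.fst → v ≠ d.snd → P (Sum.inl v) = Pauli.I) ∧
    (∀ a, P (Sum.inr a) ≠ Pauli.I → E.Adjacent d (loc a)) ∧
    (∀ a b, P (Sum.inr a) ≠ Pauli.I → P (Sum.inr b) ≠ Pauli.I → a = b)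

/-- The set of the face cycles, of bounded faces, that lie in the kernel `K` of the encoding. -/
def kernelFaceCycles {V Q : Type*} [Fintype Q] [DecidableEq Q] {G : SimpleGraph V}
    (E : PlaneEmbedding G) (σ : EVGroup G →* QubitOp Q) : Set (EVGroup.cycleGroup G) :=
  {c | c ∈ encodingKernel σ ∧ ∃ f : E.Face, f ≠ E.outer ∧ E.IsFaceCycle f (c : EVGroup G)}

/-! Up to phases, Pauli strings are vectors over `ZMod 2`, and an element of `M_G` has an edge class
in `G.edgeSet → ZMod 2`. Since nothing in the cycle group maps to `-1`, phases take care of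
themselves: an element of the cycle group is determined by its edge class (`eq_of_edgeClass_eq`),
and it lies in `K` as soon as its string is trivial on every qubit (`map_eq_one_iff`). By Euler's
formula its edge class bounds a set `s` of bounded faces (`exists_bdry_eq`), so the problem becomes
linear algebra on sets of faces.

The core is local. Two edges at a vertex `v` anticommute. If they have the same letter `X` or `Y` on
`v`, they must anticommute on an auxiliary qubit, whose face is then adjacent to both. That face is
simple, so it has a single corner at `v`, and the two edges are the sides of this corner: a paired
corner. As an edge acts on at most one auxiliary qubit, paired corners at `v` share no edge. If the
boundary of `s` is trivial on the vertex qubits, it contains both or neither of the edges of a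
paired corner, and no edge of `v` outside such corners. Hence `s` takes a single value on the
unpaired corners at `v`. No edge has paired corners on both of its sides, so this value is the same
at all vertices, and the outer face shows that it is `0`. Every face in `s` therefore has only
paired corners (`paired_of_ne_zero`).

Along the boundary of such a face, consecutive edges anticommute on its auxiliary qubit, while
disjoint edges agree there. This leaves three sides, with `X`, `Y`, `Z` in some order, or four, with
two alternating letters (`minimalPeriod_of_paired_face`). Either way the face cycle itself is in `K`
(`sum_vec_of_paired_face`), so the face cycles in `K` generate it. Minimality follows from the
linear independence of the boundaries of bounded faces. -/

/-! ### Multiplication and commutation of Pauli strings -/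

namespace Pauli

/-- The symplectic vector `(x, z)` of a Pauli operator, which determines it up to a phase. -/
def vec : Pauli → ZMod 2 × ZMod 2
  | I => (0, 0)
  | X => (1, 0)
  | Y => (1, 1)
  | Z => (0, 1)

/-- The symplectic form: `0` if two Pauli operators commute, `1` if they anticommute. -/
def symp (P P' : Pauli) : ZMod 2 := P.vec.1 * P'.vec.2 + P.vec.2 * P'.vec.1

theorem vec_injective : Function.Injective vec := by
  intro P P' h
  cases P <;> cases P' <;> first
    | rfl
    | exact absurd h (by decide)

theorem vec_eq_zero_iff {P : Pauli} : P.vec = 0 ↔ P = I :=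
  ⟨fun h => vec_injective (h.trans rfl), fun h => h ▸ rfl⟩

theorem symp_self (P : Pauli) : symp P P = 0 := by cases P <;> decide

theorem symp_I_left (P : Pauli) : symp I P = 0 := by cases P <;> decide

theorem symp_I_right (P : Pauli) : symp P I = 0 := by cases P <;> decide

theorem eq_of_symp_eq_zero {P P' : Pauli} (hP : P ≠ I) (hP' : P' ≠ I) (h : symp P P' = 0) :
    P = P' := by
  cases P <;> cases P' <;> first
    | rfl
    | exact absurd rfl hP
    | exact absurd rfl hP'
    | exact absurd h (by decide)

/-- Pairwise anticommuting Pauli operators are `X`, `Y`, `Z` in some order, with product a phase.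
This settles the auxiliary qubit of a triangular face. -/
theorem vec_add_vec_add_vec {P P' P'' : Pauli} (h : symp P P' = 1) (h' : symp P' P'' = 1)
    (h'' : symp P'' P = 1) : P.vec + (P'.vec + P''.vec) = 0 := by
  cases P <;> cases P' <;> cases P'' <;> first
    | decide
    | exact absurd h (by decide)
    | exact absurd h' (by decide)
    | exact absurd h'' (by decide)

theorem toMatrix_mul (P P' : Pauli) : ∃ (k : ℕ) (P'' : Pauli),
    P.toMatrix * P'.toMatrix = Complex.I ^ k • P''.toMatrix ∧ P''.vec = P.vec + P'.vec := by
  have h3 : Complex.I ^ 3 = -Complex.I := by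
    rw [pow_succ, Complex.I_sq]; ring
  cases P <;> cases P'
  · exact ⟨0, I, by simp [toMatrix], by decide⟩
  · exact ⟨0, X, by simp [toMatrix], by decide⟩
  · exact ⟨0, Y, by simp [toMatrix], by decide⟩
  · exact ⟨0, Z, by simp [toMatrix], by decide⟩
  · exact ⟨0, X, by simp [toMatrix], by decide⟩
  · exact ⟨0, I, by simp [toMatrix], by decide⟩
  · exact ⟨1, Z, by simp [toMatrix], by decide⟩
  · exact ⟨3, Y, by simp [toMatrix, h3], by decide⟩
  · exact ⟨0, Y, by simp [toMatrix], by decide⟩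
  · exact ⟨3, Z, by simp [toMatrix, h3], by decide⟩
  · exact ⟨0, I, by simp [toMatrix], by decide⟩
  · exact ⟨1, X, by simp [toMatrix], by decide⟩
  · exact ⟨0, Z, by simp [toMatrix], by decide⟩
  · exact ⟨1, Y, by simp [toMatrix], by decide⟩
  · exact ⟨3, X, by simp [toMatrix, h3], by decide⟩
  · exact ⟨0, I, by simp [toMatrix], by decide⟩

theorem toMatrix_mul_self (P : Pauli) : P.toMatrix * P.toMatrix = 1 := by
  rw [Matrix.one_fin_two]
  cases P <;> simp [toMatrix]

theorem toMatrix_mul_comm (P P' : Pauli) :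
    P.toMatrix * P'.toMatrix = (-1 : ℂ) ^ (symp P P').val • (P'.toMatrix * P.toMatrix) := by
  have h0 : (0 : ZMod 2).val = 0 := rfl
  have h1 : (1 : ZMod 2).val = 1 := rfl
  have h2 : (1 + 1 : ZMod 2) = 0 := by decide
  cases P <;> cases P' <;> simp [toMatrix, symp, vec, h1, h2]

end Pauli

section PauliString

variable {Q : Type*} [Fintype Q]

/-- The tensor product of single-qubit operators. -/
def tensorOp (M : Q → Matrix (Fin 2) (Fin 2) ℂ) : QubitOp Q := fun s t => ∏ q, M q (s q) (t q)

theorem pauliString_eq_tensorOp (P : Q → Pauli) :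
    pauliString P = tensorOp fun q => (P q).toMatrix := rfl

theorem tensorOp_mul [DecidableEq Q] (M N : Q → Matrix (Fin 2) (Fin 2) ℂ) :
    tensorOp M * tensorOp N = tensorOp fun q => M q * N q := by
  ext s t
  simp only [tensorOp, Matrix.mul_apply, ← Finset.prod_mul_distrib]
  rw [Finset.prod_univ_sum, Fintype.piFinset_univ]

theorem tensorOp_smul (c : Q → ℂ) (M : Q → Matrix (Fin 2) (Fin 2) ℂ) :
    (tensorOp fun q => c q • M q) = (∏ q, c q) • tensorOp M := by
  ext s t
  simp [tensorOp, Finset.prod_mul_distrib]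

theorem tensorOp_one [DecidableEq Q] :
    (tensorOp fun _ => 1 : QubitOp Q) = 1 := by
  ext s t
  simp only [tensorOp, Matrix.one_apply]
  split_ifs with h
  · simp [h]
  · obtain ⟨q, hq⟩ := Function.ne_iff.1 h
    exact Finset.prod_eq_zero (Finset.mem_univ q) (if_neg hq)

variable [DecidableEq Q]

theorem pauliString_mul (P P' : Q → Pauli) : ∃ (k : ℕ) (P'' : Q → Pauli),
    pauliString P * pauliString P' = Complex.I ^ k • pauliString P'' ∧
      ∀ q, (P'' q).vec = (P q).vec + (P' q).vec := by
  choose k R hR hv using fun q => Pauli.toMatrix_mul (P q) (P' q)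
  refine ⟨∑ q, k q, R, ?_, hv⟩
  simp only [pauliString_eq_tensorOp, tensorOp_mul, hR, tensorOp_smul, Finset.prod_pow_eq_pow_sum]

theorem pauliString_mul_self (P : Q → Pauli) : pauliString P * pauliString P = 1 := by
  simp only [pauliString_eq_tensorOp, tensorOp_mul, Pauli.toMatrix_mul_self, tensorOp_one]

theorem neg_one_pow_val_sum {ι : Type*} (s : Finset ι) (f : ι → ZMod 2) :
    ∏ i ∈ s, (-1 : ℂ) ^ (f i).val = (-1) ^ (∑ i ∈ s, f i).val := by
  classical
  have h : ∀ a b : ZMod 2, (-1 : ℂ) ^ (a + b).val = (-1) ^ a.val * (-1) ^ b.val := by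
    intro a b
    rw [ZMod.val_add, ← neg_one_pow_eq_pow_mod_two, pow_add]
  induction s using Finset.induction_on with
  | empty => simp
  | insert a s ha ih => rw [Finset.prod_insert ha, Finset.sum_insert ha, ih, h]

theorem pauliString_mul_comm (P P' : Q → Pauli) :
    pauliString P * pauliString P' =
      (-1 : ℂ) ^ (∑ q, (P q).symp (P' q)).val • (pauliString P' * pauliString P) := by
  simp only [pauliString_eq_tensorOp, tensorOp_mul]
  rw [← neg_one_pow_val_sum, ← tensorOp_smul]
  congr 1
  funext q
  exact Pauli.toMatrix_mul_comm _ _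

theorem pauliString_mul_ne_zero (P P' : Q → Pauli) : pauliString P * pauliString P' ≠ 0 := by
  intro h
  have h1 : pauliString P * (pauliString P * pauliString P') * pauliString P' = 1 := by
    rw [← mul_assoc, pauliString_mul_self, one_mul, pauliString_mul_self]
  rw [h] at h1
  simp at h1

/-- The symplectic form of two Pauli strings is determined by how multiples of them commute. -/
theorem symp_sum_of_smul_mul {c c' : ℂ} (hc : c ≠ 0) (hc' : c' ≠ 0) (P P' : Q → Pauli)
    (a : ZMod 2) (h : (c • pauliString P) * (c' • pauliString P') =
      (-1 : ℂ) ^ a.val • ((c' • pauliString P') * (c • pauliString P))) :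
    ∑ q, (P q).symp (P' q) = a := by
  simp only [Matrix.smul_mul, Matrix.mul_smul, smul_smul] at h
  rw [pauliString_mul_comm P P', smul_smul] at h
  have h2 := smul_left_injective ℂ (pauliString_mul_ne_zero P' P) h
  have h3 : (-1 : ℂ) ^ (∑ q, (P q).symp (P' q)).val = (-1) ^ a.val := by
    apply mul_left_cancel₀ (mul_ne_zero hc hc')
    linear_combination h2
  generalize ∑ q, (P q).symp (P' q) = b at h3
  clear h h2
  have h0 : (0 : ZMod 2).val = 0 := rfl
  have h1 : (1 : ZMod 2).val = 1 := rfl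
  have h01 : ∀ x : ZMod 2, x = 0 ∨ x = 1 := by decide
  rcases h01 a with rfl | rfl <;> rcases h01 b with rfl | rfl
  · rfl
  · norm_num [h0, h1] at h3
  · norm_num [h0, h1] at h3
  · rfl

theorem pauliString_I : pauliString (fun _ : Q => Pauli.I) = 1 := by
  rw [pauliString_eq_tensorOp, ← tensorOp_one]
  simp [Pauli.toMatrix, Matrix.one_fin_two]

/-- The diagonal entries decide: a factor `X` or `Y` makes them all vanish, and a factor `Z` at `q`
makes them change sign with the bit at `q`. -/
theorem eq_I_of_smul_pauliString_eq_one {c : ℂ} {P : Q → Pauli} (h : c • pauliString P = 1) (q : Q) :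
    P q = Pauli.I := by
  have hd : ∀ s : Q → Fin 2, c * ∏ q, (P q).toMatrix (s q) (s q) = 1 := by
    intro s
    have := congrFun (congrFun h s) s
    simpa [pauliString] using this
  have hIZ : ∀ q, P q = Pauli.I ∨ P q = Pauli.Z := by
    intro q
    by_contra hq
    have h0 : ∏ q, (P q).toMatrix 0 0 = 0 := by
      apply Finset.prod_eq_zero (Finset.mem_univ q)
      cases hP : P q <;> simp_all [Pauli.toMatrix]
    have := hd 0
    simp only [Pi.zero_apply] at this
    rw [h0] at this
    simp at this
  rcases hIZ q with hq | hq
  · exact hq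
  exfalso
  have h0 : ∏ q, (P q).toMatrix 0 0 = 1 := by
    apply Finset.prod_eq_one
    intro r _
    rcases hIZ r with h | h <;> simp [h, Pauli.toMatrix]
  have h1 : ∏ r, (P r).toMatrix ((Function.update 0 q 1 : Q → Fin 2) r)
      ((Function.update 0 q 1 : Q → Fin 2) r) = -1 := by
    rw [Finset.prod_eq_single q]
    · simp [hq, Pauli.toMatrix]
    · intro r _ hr
      rcases hIZ r with h | h <;> simp [h, hr, Pauli.toMatrix]
    · simp
  have e0 := hd 0
  have e1 := hd (Function.update 0 q 1)
  simp only [Pi.zero_apply] at e0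
  rw [h0] at e0
  rw [h1] at e1
  rw [mul_one] at e0
  rw [e0] at e1
  norm_num at e1

end PauliString

/-! ### The edge class of an element of `M_G` -/

section DartVec

variable {V : Type*} {G : SimpleGraph V}

/-- The edge underlying a dart. -/
def dartEdge (d : G.Dart) : G.edgeSet := ⟨d.edge, d.edge_mem⟩

theorem dartEdge_symm (d : G.Dart) : dartEdge d.symm = dartEdge d := Subtype.ext d.edge_symm

theorem dartEdge_eq_iff {d d' : G.Dart} : dartEdge d = dartEdge d' ↔ d = d' ∨ d = d'.symm := by
  rw [← SimpleGraph.dart_edge_eq_iff, Subtype.ext_iff]; rfl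

theorem dartEdge_surjective : Function.Surjective (dartEdge : G.Dart → G.edgeSet) := by
  rintro ⟨e, he⟩
  induction e using Sym2.ind with
  | _ u v => exact ⟨⟨(u, v), he⟩, rfl⟩

open Classical in
/-- The indicator function modulo two of the edge underlying a dart. -/
noncomputable def dartVec (d : G.Dart) : G.edgeSet → ZMod 2 := Pi.single (dartEdge d) 1

theorem dartVec_symm (d : G.Dart) : dartVec d.symm = dartVec d := by
  rw [dartVec, dartVec, dartEdge_symm]

theorem cochain_add_self (y : G.edgeSet → ZMod 2) : y + y = 0 := by
  ext e
  exact CharTwo.add_self_eq_zero (y e)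

theorem dartVec_apply_self (d : G.Dart) : dartVec d (dartEdge d) = 1 := by
  classical
  simp [dartVec]

theorem dartVec_apply_of_ne {d : G.Dart} {e : G.edgeSet} (h : e ≠ dartEdge d) :
    dartVec d e = 0 := by
  classical
  simp [dartVec, h]

end DartVec

namespace EVGroup

variable {V : Type*} {G : SimpleGraph V}

theorem mk_eq_of_rel {x y : FreeGroup (EVGen G)} (h : EVGen.Rel G x y) :
    (PresentedGroup.mk _ x : EVGroup G) = PresentedGroup.mk _ y :=
  PresentedGroup.mk_eq_mk_of_mul_inv_mem ⟨x, y, h, rfl⟩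

theorem phase_mul (k l : ZMod 4) : phase G k * phase G l = phase G (k + l) :=
  mk_eq_of_rel (EVGen.Rel.phase_mul k l)

theorem phase_zero : phase G 0 = 1 := by
  have h := phase_mul (G := G) 0 0
  rwa [add_zero, mul_eq_left] at h

theorem phase_comm (k : ZMod 4) (m : EVGroup G) : phase G k * m = m * phase G k := by
  have h : m ∈ Subgroup.centralizer {phase G k} :=
    PresentedGroup.generated_by _ _ (fun g => Subgroup.mem_centralizer_singleton_iff.2
      (mk_eq_of_rel (EVGen.Rel.phase_central k g)).symm) m
  exact (Subgroup.mem_centralizer_singleton_iff.1 h).symm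

theorem phase_inv (k : ZMod 4) : (phase G k)⁻¹ = phase G (-k) :=
  inv_eq_of_mul_eq_one_right (by rw [phase_mul, add_neg_cancel, phase_zero])

theorem edge_mul_self (d : G.Dart) : edge G d * edge G d = 1 :=
  mk_eq_of_rel (EVGen.Rel.edge_sq d)

theorem edge_inv (d : G.Dart) : (edge G d)⁻¹ = edge G d :=
  inv_eq_of_mul_eq_one_right (edge_mul_self d)

theorem edge_eq_symm (d : G.Dart) : edge G d = phase G 2 * edge G d.symm :=
  mk_eq_of_rel (EVGen.Rel.edge_symm d)

theorem edge_comm {d d' : G.Dart} (h1 : d.fst ≠ d'.fst) (h2 : d.fst ≠ d'.snd)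
    (h3 : d.snd ≠ d'.fst) (h4 : d.snd ≠ d'.snd) : edge G d * edge G d' = edge G d' * edge G d :=
  mk_eq_of_rel (EVGen.Rel.edge_edge_comm d d' h1 h2 h3 h4)

theorem edge_anticomm {d d' : G.Dart} (h1 : d.snd = d'.fst) (h2 : d.fst ≠ d'.snd) :
    edge G d * edge G d' = phase G 2 * (edge G d' * edge G d) :=
  mk_eq_of_rel (EVGen.Rel.edge_edge_anticomm d d' h1 h2)

/-- Two elements commute up to a phase. -/
def CommUpToPhase (x y : EVGroup G) : Prop := ∃ k, x * y = phase G k * (y * x)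

theorem CommUpToPhase.phase_mul_left {x y : EVGroup G} (h : CommUpToPhase x y) (l : ZMod 4) :
    CommUpToPhase (phase G l * x) y := by
  obtain ⟨k, hk⟩ := h
  refine ⟨k, ?_⟩
  rw [mul_assoc, hk, ← mul_assoc y, ← phase_comm l y, ← mul_assoc, phase_comm l]
  simp only [mul_assoc]

theorem CommUpToPhase.symm {x y : EVGroup G} (h : CommUpToPhase x y) : CommUpToPhase y x := by
  obtain ⟨k, hk⟩ := h
  refine ⟨-k, ?_⟩
  rw [hk, ← mul_assoc, phase_mul, neg_add_cancel, phase_zero, one_mul]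

/-- Reversing a dart only changes a sign, so two edges with a common vertex may be taken head to
tail, as in the defining relation. -/
theorem commUpToPhase_edge (d d' : G.Dart) : CommUpToPhase (edge G d) (edge G d') := by
  have left : ∀ {d d' : G.Dart}, CommUpToPhase (edge G d.symm) (edge G d') →
      CommUpToPhase (edge G d) (edge G d') := by
    intro d d' h
    rw [edge_eq_symm d]
    exact h.phase_mul_left 2
  have base : ∀ {d d' : G.Dart}, d.snd = d'.fst → CommUpToPhase (edge G d) (edge G d') := by
    intro d d' h
    by_cases h' : d.fst = d'.snd
    · have : d = d'.symm := SimpleGraph.Dart.ext _ _ (Prod.ext h' h)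
      subst this
      exact left ⟨0, by rw [SimpleGraph.Dart.symm_symm, phase_zero, one_mul]⟩
    · exact ⟨2, edge_anticomm h h'⟩
  by_cases h3 : d.snd = d'.fst
  · exact base h3
  by_cases h1 : d.fst = d'.fst
  · exact left (base h1)
  by_cases h2 : d.fst = d'.snd
  · exact (base h2.symm).symm
  by_cases h4 : d.snd = d'.snd
  · exact (left (base (d' := d'.symm) h4).symm).symm
  · exact ⟨0, by rw [edge_comm h1 h2 h3 h4, phase_zero, one_mul]⟩

/-- The edge class of an element of `M_G`: the edges that occur in it an odd number of times. -/
noncomputable def edgeClass : EVGroup G →* Multiplicative (G.edgeSet → ZMod 2) :=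
  PresentedGroup.toGroup
    (f := fun g => match g with
      | EVGen.phase _ => 1
      | EVGen.vertex _ => 1
      | EVGen.edge d => Multiplicative.ofAdd (dartVec d)) <| by
    -- The target is commutative of exponent two and phases go to `1`, so signs and orders in the
    -- relations are invisible.
    rintro _ ⟨x, y, h, rfl⟩
    rw [map_mul, map_inv, mul_inv_eq_one]
    cases h with
    | phase_mul k l => simp [EVGen.ph]
    | phase_central k g => rw [map_mul, map_mul, mul_comm]
    | edge_sq d => simp [EVGen.ed, ← ofAdd_add, cochain_add_self]
    | vertex_sq v => simp [EVGen.ve]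
    | edge_symm d => simp [EVGen.ed, EVGen.ph, dartVec_symm]
    | vertex_comm v w => rw [map_mul, map_mul, mul_comm]
    | edge_vertex_comm d v => rw [map_mul, map_mul, mul_comm]
    | edge_edge_comm d d' => rw [map_mul, map_mul, mul_comm]
    | edge_vertex_anticomm d => simp [EVGen.ed, EVGen.ph, EVGen.ve]
    | edge_edge_anticomm d d' => simp [EVGen.ed, EVGen.ph, mul_comm]

theorem edgeClass_phase (k : ZMod 4) : (edgeClass (phase G k)).toAdd = 0 := by
  rw [edgeClass, phase, PresentedGroup.toGroup.of]; rfl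

theorem edgeClass_edge (d : G.Dart) : (edgeClass (edge G d)).toAdd = dartVec d := by
  rw [edgeClass, edge, PresentedGroup.toGroup.of]; rfl

theorem edgeClass_prod (l : List G.Dart) :
    (edgeClass (l.map (edge G)).prod).toAdd = (l.map dartVec).sum := by
  induction l with
  | nil => simp
  | cons d l ih => simp [ih, edgeClass_edge]

theorem edgeClass_loopElement (l : List G.Dart) :
    (edgeClass (loopElement G l)).toAdd = (l.map dartVec).sum := by
  rw [loopElement, map_mul, toAdd_mul, edgeClass_phase, edgeClass_prod, zero_add]

theorem exists_prod_eq_edge_mul {d : G.Dart} {l : List G.Dart}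
    (h : dartEdge d ∈ l.map dartEdge) : ∃ (k : ZMod 4) (l' : List G.Dart),
      l'.length + 1 = l.length ∧
      (l.map (edge G)).prod = phase G k * (edge G d * (l'.map (edge G)).prod) := by
  induction l with
  | nil => simp at h
  | cons a l ih =>
    by_cases ha : dartEdge d = dartEdge a
    · rcases dartEdge_eq_iff.1 ha with rfl | rfl
      · exact ⟨0, l, rfl, by simp [phase_zero]⟩
      · refine ⟨2, l, rfl, ?_⟩
        rw [List.map_cons, List.prod_cons, edge_eq_symm a, mul_assoc]
    · obtain ⟨k, l', hl, hp⟩ := ih (by simpa [ha] using h)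
      obtain ⟨j, hj⟩ := commUpToPhase_edge a d
      refine ⟨k + j, a :: l', by simp [hl], ?_⟩
      rw [List.map_cons, List.prod_cons, hp, ← mul_assoc, ← phase_comm, mul_assoc, ← mul_assoc (edge G a),
        hj, List.map_cons, List.prod_cons, ← phase_mul]
      simp only [mul_assoc]

/-- The first edge has to occur again; moving that occurrence forward costs a phase, and the pair
cancels. -/
theorem exists_prod_eq_phase (l : List G.Dart) (h : (l.map dartVec).sum = 0) :
    ∃ k, (l.map (edge G)).prod = phase G k := by
  induction hn : l.length using Nat.strong_induction_on generalizing l with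
  | _ n ih =>
    cases l with
    | nil => exact ⟨0, by simp [phase_zero]⟩
    | cons d l =>
      have hd : dartEdge d ∈ l.map dartEdge := by
        by_contra hd
        have h1 := congrFun h (dartEdge d)
        have h2 : ∀ l : List G.Dart, dartEdge d ∉ l.map dartEdge →
            (l.map dartVec).sum (dartEdge d) = 0 := by
          intro l
          induction l with
          | nil => simp
          | cons a l ih =>
            intro h
            rw [List.map_cons, List.mem_cons, not_or] at h
            rw [List.map_cons, List.sum_cons, Pi.add_apply, ih h.2, dartVec_apply_of_ne h.1,
              add_zero]
        rw [List.map_cons, List.sum_cons, Pi.add_apply, dartVec_apply_self, h2 l hd] at h1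
        simp at h1
      obtain ⟨k, l', hl, hp⟩ := exists_prod_eq_edge_mul hd
      have hs : (l.map dartVec).sum = dartVec d + (l'.map dartVec).sum := by
        rw [← edgeClass_prod, hp, map_mul, toAdd_mul, map_mul, toAdd_mul, edgeClass_phase,
          edgeClass_edge, edgeClass_prod, zero_add]
      have h' : (l'.map dartVec).sum = 0 := by
        rwa [List.map_cons, List.sum_cons, hs, ← add_assoc, cochain_add_self, zero_add] at h
      simp only [List.length_cons] at hn
      obtain ⟨j, hj⟩ := ih l'.length (by omega) l' h' rfl
      refine ⟨k + j, ?_⟩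
      rw [List.map_cons, List.prod_cons, hp, hj, ← mul_assoc, ← phase_comm, mul_assoc,
        ← mul_assoc (edge G d), edge_mul_self, one_mul, phase_mul]

theorem exists_eq_phase_mul_prod {c : EVGroup G} (hc : c ∈ cycleGroup G) :
    ∃ (k : ZMod 4) (l : List G.Dart), c = phase G k * (l.map (edge G)).prod := by
  induction hc using Subgroup.closure_induction with
  | mem x hx =>
    obtain ⟨u, w, rfl⟩ := hx
    exact ⟨_, _, rfl⟩
  | one => exact ⟨0, [], by simp [phase_zero]⟩
  | mul x y _ _ hx hy =>
    obtain ⟨k, l, rfl⟩ := hx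
    obtain ⟨k', l', rfl⟩ := hy
    refine ⟨k + k', l ++ l', ?_⟩
    rw [List.map_append, List.prod_append, ← phase_mul, mul_assoc, mul_assoc, ← mul_assoc _ (phase G k'),
      ← phase_comm k', mul_assoc]
  | inv x _ hx =>
    obtain ⟨k, l, rfl⟩ := hx
    refine ⟨-k, l.reverse, ?_⟩
    rw [mul_inv_rev, List.prod_inv_reverse, phase_inv, ← phase_comm, List.map_map,
      List.map_reverse]
    congr 4
    funext d
    exact edge_inv d

end EVGroup

/-! ### Faces of a rotation system -/

theorem Equiv.Perm.SameCycle.apply_eq_of_invariant {α β : Type*} [Finite α] {f : Equiv.Perm α}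
    {t : α → β} (ht : ∀ x, t (f x) = t x) {x y : α} (h : f.SameCycle x y) : t x = t y := by
  obtain ⟨n, rfl⟩ := h.exists_nat_pow_eq
  induction n with
  | zero => rfl
  | succ n ih =>
    rw [pow_succ', Equiv.Perm.mul_apply, ht]
    exact ih ⟨n, by simp⟩

theorem SimpleGraph.Dart.finite {V : Type*} [Finite V] (G : SimpleGraph V) : Finite G.Dart :=
  Finite.of_injective _ SimpleGraph.Dart.toProd_injective

namespace RotationSystem

variable {V : Type*} {G : SimpleGraph V} (R : RotationSystem G)

theorem faceNext_apply (d : G.Dart) : R.faceNext d = R.rot d.symm := rfl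

theorem faceNext_fst (d : G.Dart) : (R.faceNext d).fst = d.snd := R.rot_fst d.symm

theorem faceNext_ne (d : G.Dart) : R.faceNext d ≠ d := by
  intro h
  exact d.fst_ne_snd (by rw [← R.faceNext_fst d, h])

theorem faceOf_eq_iff {d d' : G.Dart} :
    R.faceOf d = R.faceOf d' ↔ R.faceNext.SameCycle d d' :=
  Sum.inl_injective.eq_iff.trans Quotient.eq

theorem faceOf_faceNext (d : G.Dart) : R.faceOf (R.faceNext d) = R.faceOf d :=
  (R.faceOf_eq_iff.2 (Equiv.Perm.sameCycle_apply_right.2 (Equiv.Perm.SameCycle.refl _ _))).symm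

theorem faceOf_rot (d : G.Dart) : R.faceOf (R.rot d) = R.faceOf d.symm := by
  rw [← R.faceOf_faceNext d.symm, faceNext_apply, SimpleGraph.Dart.symm_symm]

/-- A function on the darts of a connected graph that is constant around vertices and along edges
is constant. -/
theorem eq_of_invariant [Finite G.Dart] (hG : G.Connected) {β : Type*} {t : G.Dart → β}
    (hrot : ∀ d, t (R.rot d) = t d) (hsymm : ∀ d, t d.symm = t d) (d d' : G.Dart) :
    t d = t d' := by
  have hv : ∀ {d d' : G.Dart}, d.fst = d'.fst → t d = t d' := fun h =>
    (R.rot_sameCycle _ _ h).apply_eq_of_invariant hrot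
  have hw : ∀ {u v : V} (_ : G.Walk u v) (d d' : G.Dart), d.fst = u → d'.fst = v → t d = t d' := by
    intro u v w
    induction w with
    | nil => intro d d' h h'; exact hv (h.trans h'.symm)
    | cons h p ih =>
      intro d d' hd hd'
      rw [hv (d' := ⟨(_, _), h⟩) hd, ← hsymm]
      exact ih _ _ rfl hd'
  obtain ⟨w⟩ := hG.preconnected d.fst d'.fst
  exact hw w d d' rfl rfl

/-! ### Boundary walks -/

theorem mem_boundaryFrom [Finite G.Dart] {d x : G.Dart} :
    x ∈ R.boundaryFrom d ↔ R.faceOf x = R.faceOf d := by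
  rw [boundaryFrom, List.mem_iterate, eq_comm (a := R.faceOf x), faceOf_eq_iff]
  constructor
  · rintro ⟨m, _, rfl⟩
    exact ⟨m, by rw [zpow_natCast, Equiv.Perm.iterate_eq_pow]⟩
  · intro h
    obtain ⟨n, rfl⟩ := h.exists_nat_pow_eq
    refine ⟨n % Function.minimalPeriod R.faceNext d, Nat.mod_lt _ ?_, ?_⟩
    · exact Function.minimalPeriod_pos_of_mem_periodicPts
        (R.faceNext.injective.mem_periodicPts d)
    · rw [Function.iterate_mod_minimalPeriod_eq, Equiv.Perm.iterate_eq_pow]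

theorem nodup_boundaryFrom (d : G.Dart) : (R.boundaryFrom d).Nodup := by
  rw [boundaryFrom, ← List.range_map_iterate]
  refine List.Nodup.map_on ?_ List.nodup_range
  intro i hi j hj h
  exact Function.iterate_injOn_Iio_minimalPeriod (List.mem_range.1 hi) (List.mem_range.1 hj) h

theorem length_boundaryFrom (d : G.Dart) :
    (R.boundaryFrom d).length = Function.minimalPeriod R.faceNext d := List.length_iterate _ _ _

theorem sides_faceOf [Finite G.Dart] (d : G.Dart) :
    R.sides (R.faceOf d) = Function.minimalPeriod R.faceNext d := by
  classical
  have h : {x : G.Dart | R.faceOf x = R.faceOf d} = ((R.boundaryFrom d).toFinset : Set G.Dart) := by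
    ext x
    simp [mem_boundaryFrom]
  rw [sides, ← length_boundaryFrom, ← List.toFinset_card_of_nodup (R.nodup_boundaryFrom d),
    ← Set.ncard_coe_finset, ← h]
  rfl

open Classical in
theorem sum_boundaryFrom [Fintype G.Dart] {M : Type*} [AddCommMonoid M] (g : G.Dart → M)
    (d : G.Dart) :
    ((R.boundaryFrom d).map g).sum = ∑ x, if R.faceOf x = R.faceOf d then g x else 0 := by
  rw [← List.sum_toFinset g (R.nodup_boundaryFrom d), ← Finset.sum_filter]
  refine Finset.sum_congr ?_ fun _ _ => rfl
  ext x
  simp [mem_boundaryFrom]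

theorem exists_walk_darts_eq_iterate (n : ℕ) (d : G.Dart) :
    ∃ w : G.Walk d.fst (R.faceNext^[n] d).fst, w.darts = List.iterate R.faceNext d n := by
  induction n generalizing d with
  -- The walk of length `n` ends where its next dart would start; at the minimal period this is the
  -- starting vertex.
  | zero => exact ⟨SimpleGraph.Walk.nil, rfl⟩
  | succ n ih =>
    obtain ⟨w, hw⟩ := ih (R.faceNext d)
    have h : G.Adj d.fst (R.faceNext d).fst := by
      rw [faceNext_fst]
      exact d.adj
    refine ⟨SimpleGraph.Walk.cons h w, (SimpleGraph.Walk.darts_cons h w).trans ?_⟩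
    rw [hw, List.iterate]
    congr 1
    exact SimpleGraph.Dart.ext _ _ (Prod.ext rfl (R.faceNext_fst d))

theorem loopElement_boundaryFrom_mem (d : G.Dart) :
    EVGroup.loopElement G (R.boundaryFrom d) ∈ EVGroup.cycleGroup G := by
  obtain ⟨w, hw⟩ := R.exists_walk_darts_eq_iterate (Function.minimalPeriod R.faceNext d) d
  refine Subgroup.subset_closure
    ⟨d.fst, w.copy rfl (by rw [Function.iterate_minimalPeriod]), ?_⟩
  rw [SimpleGraph.Walk.darts_copy, hw, boundaryFrom]

/-! ### Face boundaries modulo two -/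

/-- The edge set, modulo two, that bounds a set of faces given by its indicator function. -/
noncomputable def bdry [Fintype G.Dart] : (R.Face → ZMod 2) →ₗ[ZMod 2] (G.edgeSet → ZMod 2) where
  toFun s := ∑ d, s (R.faceOf d) • dartVec d
  map_add' s s' := by simp [add_smul, Finset.sum_add_distrib]
  map_smul' c s := by simp [Finset.smul_sum, smul_smul]

variable [Fintype G.Dart]

theorem bdry_apply (s : R.Face → ZMod 2) :
    R.bdry s = ∑ d, s (R.faceOf d) • dartVec d := rfl

theorem bdry_dartEdge (s : R.Face → ZMod 2) (d : G.Dart) :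
    R.bdry s (dartEdge d) = s (R.faceOf d) + s (R.faceOf d.symm) := by
  classical
  rw [bdry_apply, Finset.sum_apply, Finset.sum_eq_add d d.symm d.symm_ne.symm]
  · simp only [Pi.smul_apply, dartVec_symm, dartVec_apply_self, smul_eq_mul, mul_one]
  · intro x _ hx
    rw [Pi.smul_apply, dartVec_apply_of_ne, smul_zero]
    intro h
    rcases dartEdge_eq_iff.1 h with h | h
    · exact hx.1 h.symm
    · exact hx.2 (by rw [h, SimpleGraph.Dart.symm_symm])
  · simp
  · simp

open Classical in
theorem edgeClass_loopElement_boundaryFrom (d : G.Dart) :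
    (EVGroup.edgeClass (EVGroup.loopElement G (R.boundaryFrom d))).toAdd =
      R.bdry (Pi.single (R.faceOf d) 1) := by
  rw [EVGroup.edgeClass_loopElement, sum_boundaryFrom, bdry_apply]
  refine Finset.sum_congr rfl fun x _ => ?_
  by_cases h : R.faceOf x = R.faceOf d <;> simp [h]

/-- An indicator function of faces with zero boundary is constant along the darts. -/
theorem eq_of_bdry_eq_zero (hG : G.Connected) {s : R.Face → ZMod 2} (h : R.bdry s = 0)
    (d d' : G.Dart) : s (R.faceOf d) = s (R.faceOf d') := by
  have hs : ∀ d : G.Dart, s (R.faceOf d.symm) = s (R.faceOf d) := by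
    intro d
    have h1 := R.bdry_dartEdge s d
    rw [h, Pi.zero_apply] at h1
    exact (CharTwo.add_eq_zero.1 h1.symm).symm
  exact R.eq_of_invariant hG (t := fun d => s (R.faceOf d))
    (fun d => by rw [faceOf_rot, hs]) hs d d'

end RotationSystem

/-! ### The cycle space of a connected graph -/

section CycleSpace

variable {V : Type*} [DecidableEq V] {G : SimpleGraph V} [Fintype G.Dart]

/-- The set of the vertices, modulo two, that bound a set of edges. -/
noncomputable def vertexBdry (G : SimpleGraph V) [Fintype G.Dart] :
    (G.edgeSet → ZMod 2) →ₗ[ZMod 2] (V → ZMod 2) where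
  toFun y := ∑ d : G.Dart, y (dartEdge d) • Pi.single d.fst 1
  map_add' s s' := by simp only [Pi.add_apply, add_smul, Finset.sum_add_distrib]
  map_smul' c s := by simp only [Pi.smul_apply, smul_eq_mul, Finset.smul_sum, smul_smul,
    RingHom.id_apply]

theorem vertexBdry_dartVec (d : G.Dart) :
    vertexBdry G (dartVec d) = Pi.single d.fst 1 + Pi.single d.snd 1 := by
  classical
  change ∑ x : G.Dart, dartVec d (dartEdge x) • (Pi.single x.fst 1 : V → ZMod 2) = _
  rw [Finset.sum_eq_add d d.symm d.symm_ne.symm]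
  · rw [dartEdge_symm, dartVec_apply_self, one_smul, one_smul]; rfl
  · intro x _ hx
    rw [dartVec_apply_of_ne, zero_smul]
    intro h
    exact (dartEdge_eq_iff.1 h).elim hx.1 hx.2
  · simp
  · simp

theorem vertexBdry_walk {u v : V} (w : G.Walk u v) :
    vertexBdry G (w.darts.map dartVec).sum = Pi.single u 1 + Pi.single v 1 := by
  induction w with
  | nil =>
    ext x
    simp [CharTwo.add_self_eq_zero]
  | @cons a b c h p ih =>
    rw [SimpleGraph.Walk.darts_cons, List.map_cons, List.sum_cons, map_add, ih,
      vertexBdry_dartVec]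
    ext x
    change ((Pi.single a 1 : V → ZMod 2) x + (Pi.single b 1 : V → ZMod 2) x) +
      ((Pi.single b 1 : V → ZMod 2) x + (Pi.single c 1 : V → ZMod 2) x) = _
    rw [add_assoc, ← add_assoc ((Pi.single b 1 : V → ZMod 2) x), CharTwo.add_self_eq_zero, zero_add]
    rfl

theorem vertexBdry_edgeClass {c : EVGroup G} (hc : c ∈ EVGroup.cycleGroup G) :
    vertexBdry G (EVGroup.edgeClass c).toAdd = 0 := by
  induction hc using Subgroup.closure_induction with
  | mem x hx =>
    obtain ⟨u, w, rfl⟩ := hx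
    rw [EVGroup.edgeClass_loopElement, vertexBdry_walk]
    ext x
    exact CharTwo.add_self_eq_zero _
  | one => simp
  | mul x y _ _ hx hy => rw [map_mul, toAdd_mul, map_add, hx, hy, add_zero]
  | inv x _ hx => rw [map_inv, toAdd_inv, map_neg, hx, neg_zero]

/-- `faceNext` matches each arrival of a boundary walk at a vertex with the departure that follows
it. -/
theorem vertexBdry_bdry (R : RotationSystem G) (s : R.Face → ZMod 2) :
    vertexBdry G (R.bdry s) = 0 := by
  have h : ∑ d, s (R.faceOf d) • (Pi.single d.snd 1 : V → ZMod 2) =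
      ∑ d, s (R.faceOf d) • (Pi.single d.fst 1 : V → ZMod 2) := by
    rw [← Equiv.sum_comp R.faceNext fun d => s (R.faceOf d) • (Pi.single d.fst 1 : V → ZMod 2)]
    refine Finset.sum_congr rfl fun d _ => ?_
    rw [R.faceOf_faceNext, R.faceNext_fst]
  simp only [RotationSystem.bdry_apply, map_sum, map_smul, vertexBdry_dartVec, smul_add,
    Finset.sum_add_distrib, h]
  ext x
  exact CharTwo.add_self_eq_zero _

/-- A walk from `v` to `u` has boundary `v + u`, so the image and the single vector of `u` span
everything. -/
theorem card_le_finrank_range_vertexBdry [Fintype V] (hG : G.Connected) :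
    Fintype.card V ≤ Module.finrank (ZMod 2) (LinearMap.range (vertexBdry G)) + 1 := by
  obtain ⟨u⟩ := hG.nonempty
  have htop : LinearMap.range (vertexBdry G) ⊔
      Submodule.span (ZMod 2) {(Pi.single u 1 : V → ZMod 2)} = ⊤ := by
    rw [eq_top_iff, ← (Pi.basisFun (ZMod 2) V).span_eq, Submodule.span_le]
    rintro _ ⟨v, rfl⟩
    obtain ⟨w⟩ := hG.preconnected v u
    have h : (Pi.single v 1 : V → ZMod 2) =
        vertexBdry G (w.darts.map dartVec).sum + Pi.single u 1 := by
      rw [vertexBdry_walk, add_assoc]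
      ext x
      change _ = (Pi.single v 1 : V → ZMod 2) x +
        ((Pi.single u 1 : V → ZMod 2) x + (Pi.single u 1 : V → ZMod 2) x)
      rw [CharTwo.add_self_eq_zero, add_zero]
    rw [Pi.basisFun_apply, h]
    exact Submodule.add_mem_sup (LinearMap.mem_range_self _ _) (Submodule.mem_span_singleton_self _)
  have h1 := Submodule.finrank_add_le_finrank_add_finrank (LinearMap.range (vertexBdry G))
    (Submodule.span (ZMod 2) {(Pi.single u 1 : V → ZMod 2)})
  rw [htop, finrank_top, Module.finrank_fintype_fun_eq_card, finrank_span_singleton (by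
    intro h
    simpa using congrFun h u)] at h1
  exact h1

end CycleSpace

/-! ### Euler's formula and sets of bounded faces -/

namespace PlaneEmbedding

variable {V : Type*} {G : SimpleGraph V} (E : PlaneEmbedding G)

/-- A face without darts occurs only for a one-vertex graph, where it is the only face and hence the
outer one. -/
theorem exists_faceOf_of_ne_outer (hG : G.Connected) {f : E.Face} (hf : f ≠ E.outer) :
    ∃ d, E.faceOf d = f := by
  rcases f with f | ⟨v, hv⟩
  · induction f using Quotient.ind with
    | _ d => exact ⟨d, rfl⟩
  · have h1 : ∀ w, w = v := by
      intro w
      by_contra h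
      have : Nontrivial V := ⟨⟨w, v, h⟩⟩
      obtain ⟨x, hx⟩ := hG.preconnected.exists_adj_of_nontrivial v
      exact hv x hx
    rcases ho : E.outer with f | ⟨w, hw⟩
    · induction f using Quotient.ind with
      | _ d => exact absurd ((h1 d.fst).trans (h1 d.snd).symm) d.fst_ne_snd
    · obtain rfl := h1 w
      exact absurd ho.symm hf

theorem exists_faceOf_eq_outer (hG : G.Connected) (d : G.Dart) :
    ∃ d', E.faceOf d' = E.outer := by
  rcases ho : E.outer with f | ⟨v, hv⟩
  · induction f using Quotient.ind with
    | _ d => exact ⟨d, rfl⟩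
  · have : Nontrivial V := ⟨⟨_, _, d.fst_ne_snd⟩⟩
    obtain ⟨x, hx⟩ := hG.preconnected.exists_adj_of_nontrivial v
    exact absurd hx (hv x)

theorem eq_zero_of_bdry_eq_zero [Fintype G.Dart] (hG : G.Connected) {s : E.Face → ZMod 2}
    (ho : s E.outer = 0) (h : E.bdry s = 0) : s = 0 := by
  funext f
  by_cases hf : f = E.outer
  · rw [hf, ho]; rfl
  · obtain ⟨d, rfl⟩ := E.exists_faceOf_of_ne_outer hG hf
    obtain ⟨d', hd'⟩ := E.exists_faceOf_eq_outer hG d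
    rw [E.eq_of_bdry_eq_zero hG h d d', hd', ho]; rfl

/-- In a plane graph every even edge set bounds a set of bounded faces. -/
theorem exists_bdry_eq [Fintype V] [DecidableEq V] [Fintype G.Dart] (hG : G.Connected)
    {y : G.edgeSet → ZMod 2} (hy : vertexBdry G y = 0) :
    ∃ s : E.Face → ZMod 2, s E.outer = 0 ∧ E.bdry s = y := by
  classical
  have : Finite E.Face := by unfold RotationSystem.Face; infer_instance
  have := Fintype.ofFinite E.Face
  have := Fintype.ofFinite G.edgeSet
  set U : Submodule (ZMod 2) (E.Face → ZMod 2) :=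
    LinearMap.ker (LinearMap.proj (R := ZMod 2) (φ := fun _ : E.Face => ZMod 2) E.outer) with hU
  have hU1 : Fintype.card E.Face ≤ Module.finrank (ZMod 2) U + 1 := by
    have h := LinearMap.finrank_range_add_finrank_ker
      (LinearMap.proj (R := ZMod 2) (φ := fun _ : E.Face => ZMod 2) E.outer)
    rw [Module.finrank_fintype_fun_eq_card] at h
    have h1 := Submodule.finrank_le (LinearMap.range
      (LinearMap.proj (R := ZMod 2) (φ := fun _ : E.Face => ZMod 2) E.outer))
    rw [Module.finrank_self] at h1
    rw [hU]
    omega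
  have hinj : Function.Injective (E.bdry.domRestrict U) := by
    rw [injective_iff_map_eq_zero]
    rintro ⟨s, hs⟩ h
    exact Subtype.ext (E.eq_zero_of_bdry_eq_zero hG hs h)
  have hle : LinearMap.range (E.bdry.domRestrict U) ≤ LinearMap.ker (vertexBdry G) := by
    rintro _ ⟨s, rfl⟩
    exact vertexBdry_bdry _ _
  have hker := LinearMap.finrank_range_add_finrank_ker (vertexBdry G)
  rw [Module.finrank_fintype_fun_eq_card] at hker
  have hV := card_le_finrank_range_vertexBdry hG
  have heuler := E.euler
  rw [Nat.card_eq_fintype_card, Nat.card_eq_fintype_card, Nat.card_eq_fintype_card] at heuler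
  -- Dimension count: the boundaries of sets of bounded faces have dimension at least `|F| - 1`, and
  -- the even edge sets at most `|E| - |V| + 1`, which is the same number.
  have heq := Submodule.eq_of_le_of_finrank_le hle (by
    rw [LinearMap.finrank_range_of_inj hinj]
    omega)
  obtain ⟨⟨s, hs⟩, h⟩ : y ∈ LinearMap.range (E.bdry.domRestrict U) := by
    rw [heq]; exact hy
  exact ⟨s, hs, h⟩

end PlaneEmbedding

/-! ### Edge operators of weight three -/

/-- The Pauli strings `P d` that can occur as the edge operators of a weight three planar encoding:
each acts by `X` or `Y` on the qubits of its end points and on at most one auxiliary qubit, which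
belongs to an adjacent face, and they commute and anticommute as required. -/
structure IsEdgeStrings {V A : Type*} [Fintype V] [Fintype A] {G : SimpleGraph V}
    (R : RotationSystem G) (loc : A → R.Face) (P : G.Dart → V ⊕ A → Pauli) : Prop where
  symm : ∀ d, P d.symm = P d
  fst_eq : ∀ d, P d (Sum.inl d.fst) = Pauli.X ∨ P d (Sum.inl d.fst) = Pauli.Y
  vertex_eq_I : ∀ d v, v ≠ d.fst → v ≠ d.snd → P d (Sum.inl v) = Pauli.I
  adjacent : ∀ d a, P d (Sum.inr a) ≠ Pauli.I → R.Adjacent d (loc a)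
  aux_unique : ∀ d a b, P d (Sum.inr a) ≠ Pauli.I → P d (Sum.inr b) ≠ Pauli.I → a = b
  comm : ∀ d d' : G.Dart, d.fst ≠ d'.fst → d.fst ≠ d'.snd → d.snd ≠ d'.fst → d.snd ≠ d'.snd →
    ∑ q, (P d q).symp (P d' q) = 0
  anticomm : ∀ d d' : G.Dart, d.fst = d'.fst → d ≠ d' → ∑ q, (P d q).symp (P d' q) = 1

/-- The corner between `d` and `R.rot d` is paired if these two edges act by the same Pauli operator
on the vertex qubit and anticommute on the auxiliary qubit of the face at the corner. -/
structure IsPairedCorner {V A : Type*} {G : SimpleGraph V} (R : RotationSystem G)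
    (loc : A → R.Face) (P : G.Dart → V ⊕ A → Pauli) (d : G.Dart) : Prop where
  rot_ne : R.rot d ≠ d
  letter_eq : P d (Sum.inl d.fst) = P (R.rot d) (Sum.inl d.fst)
  exists_aux : ∃ a, loc a = R.faceOf (R.rot d) ∧
    (P d (Sum.inr a)).symp (P (R.rot d) (Sum.inr a)) = 1

/-- In a simple graph a return after two steps retraces the same edge, so the vertex in between
would be a leaf without a genuine corner. -/
theorem IsPairedCorner.faceNext_faceNext_ne {V A : Type*} {G : SimpleGraph V}
    {R : RotationSystem G} {loc : A → R.Face} {P : G.Dart → V ⊕ A → Pauli} {d : G.Dart}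
    (hd : IsPairedCorner R loc P d.symm) : R.faceNext (R.faceNext d) ≠ d := by
  intro h
  refine hd.rot_ne (SimpleGraph.Dart.ext _ _ (Prod.ext (R.rot_fst _) ?_))
  have := R.faceNext_fst (R.faceNext d)
  rw [h] at this
  exact this.symm

theorem Pauli.ne_I_left_of_symp {P P' : Pauli} (h : P.symp P' = 1) : P ≠ Pauli.I := by
  rintro rfl
  rw [Pauli.symp_I_left] at h
  exact zero_ne_one h

theorem Pauli.ne_I_right_of_symp {P P' : Pauli} (h : P.symp P' = 1) : P' ≠ Pauli.I := by
  rintro rfl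
  rw [Pauli.symp_I_right] at h
  exact zero_ne_one h

namespace IsEdgeStrings

variable {V A : Type*} [Fintype V] [Fintype A] {G : SimpleGraph V} {R : RotationSystem G}
  {loc : A → R.Face} {P : G.Dart → V ⊕ A → Pauli}

theorem exists_aux_of_letter_eq (h : IsEdgeStrings R loc P) {d d' : G.Dart} (hd : d.fst = d'.fst)
    (hne : d ≠ d') (hl : P d (Sum.inl d.fst) = P d' (Sum.inl d.fst)) :
    ∃ a, (P d (Sum.inr a)).symp (P d' (Sum.inr a)) = 1 := by
  have hsum := h.anticomm d d' hd hne
  rw [Fintype.sum_sum_type, Finset.sum_eq_zero, zero_add] at hsum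
  · obtain ⟨a, -, ha⟩ := Finset.exists_ne_zero_of_sum_ne_zero (hsum ▸ one_ne_zero)
    have h01 : ∀ x : ZMod 2, x ≠ 0 → x = 1 := by decide
    exact ⟨a, h01 _ ha⟩
  · intro v _
    by_cases h1 : v = d.fst
    · rw [h1, hl, Pauli.symp_self]
    by_cases h2 : v = d.snd
    · rw [h.vertex_eq_I d' v (hd ▸ h1), Pauli.symp_I_right]
      intro h3
      exact hne (SimpleGraph.Dart.ext _ _ (Prod.ext hd (h2.symm.trans h3)))
    · rw [h.vertex_eq_I d v h1 h2, Pauli.symp_I_left]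

theorem aux_eq_of_disjoint (h : IsEdgeStrings R loc P) {d d' : G.Dart} (h1 : d.fst ≠ d'.fst)
    (h2 : d.fst ≠ d'.snd) (h3 : d.snd ≠ d'.fst) (h4 : d.snd ≠ d'.snd) {a : A}
    (ha : P d (Sum.inr a) ≠ Pauli.I) (ha' : P d' (Sum.inr a) ≠ Pauli.I) :
    P d (Sum.inr a) = P d' (Sum.inr a) := by
  have hsum := h.comm d d' h1 h2 h3 h4
  rw [Fintype.sum_sum_type, Finset.sum_eq_zero, zero_add, Finset.sum_eq_single a] at hsum
  · exact Pauli.eq_of_symp_eq_zero ha ha' hsum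
  · intro b _ hb
    have : P d (Sum.inr b) = Pauli.I := by
      by_contra hb'
      exact hb (h.aux_unique d b a hb' ha)
    rw [this, Pauli.symp_I_left]
  · simp
  · intro v _
    by_cases hv : v = d.fst ∨ v = d.snd
    · rw [h.vertex_eq_I d' v, Pauli.symp_I_right]
      · rcases hv with rfl | rfl <;> assumption
      · rcases hv with rfl | rfl <;> assumption
    · rw [not_or] at hv
      rw [h.vertex_eq_I d v hv.1 hv.2, Pauli.symp_I_left]

/-- The edges anticommute on an auxiliary qubit of a face adjacent to both. This simple face has one
dart leaving the common vertex, so of the four choices of sides only the two that make the edges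
consecutive survive. -/
theorem paired_of_letter_eq (h : IsEdgeStrings R loc P) (hs : ∀ a, R.IsSimpleFace (loc a))
    {d d' : G.Dart} (hd : d.fst = d'.fst) (hne : d ≠ d')
    (hl : P d (Sum.inl d.fst) = P d' (Sum.inl d.fst)) :
    (IsPairedCorner R loc P d ∧ R.rot d = d') ∨ (IsPairedCorner R loc P d' ∧ R.rot d' = d) := by
  obtain ⟨a, ha⟩ := h.exists_aux_of_letter_eq hd hne hl
  have h1 := h.adjacent d a (Pauli.ne_I_left_of_symp ha)
  have h2 := h.adjacent d' a (Pauli.ne_I_right_of_symp ha)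
  simp only [RotationSystem.Adjacent, ← R.faceOf_rot] at h1 h2
  rcases h1 with h1 | h1 <;> rcases h2 with h2 | h2
  · exact absurd (hs a d d' h1 h2 hd) hne
  · have := hs a _ _ h2 h1 ((R.rot_fst d').trans hd.symm)
    refine Or.inr ⟨⟨by rw [this]; exact hne, by rw [this, ← hd, hl], a, h2.symm, ?_⟩, this⟩
    rw [this, Pauli.symp, add_comm, mul_comm, mul_comm (P d' _).vec.1]
    exact ha
  · have := hs a _ _ h1 h2 ((R.rot_fst d).trans hd)
    exact Or.inl ⟨⟨by rw [this]; exact hne.symm, by rw [this, hl], a, h1.symm, by rwa [this]⟩, this⟩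
  · exact absurd (R.rot.injective
      (hs a _ _ h1 h2 (by rw [R.rot_fst, R.rot_fst, hd]))) hne

/-- The shared edge would act on the auxiliary qubits of both corners. These would coincide, and a
simple face would have two corners at one vertex. -/
theorem not_paired_rot (h : IsEdgeStrings R loc P) (hs : ∀ a, R.IsSimpleFace (loc a))
    {d : G.Dart} (hd : IsPairedCorner R loc P d) : ¬ IsPairedCorner R loc P (R.rot d) := by
  intro hd'
  obtain ⟨a, ha, ha'⟩ := hd.exists_aux
  obtain ⟨b, hb, hb'⟩ := hd'.exists_aux
  obtain rfl := h.aux_unique _ a b (Pauli.ne_I_right_of_symp ha') (Pauli.ne_I_left_of_symp hb')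
  exact hd'.rot_ne (hs a _ _ hb.symm ha.symm (R.rot_fst _))

theorem exists_aux_of_paired_face {f : R.Face} (h : IsEdgeStrings R loc P) (hinj : Function.Injective loc)
    (hf : ∀ x, R.faceOf x = f → IsPairedCorner R loc P x.symm) {d : G.Dart} (hd : R.faceOf d = f) :
    ∃ a, loc a = f ∧ ∀ x, R.faceOf x = f →
      (P x (Sum.inr a)).symp (P (R.faceNext x) (Sum.inr a)) = 1 := by
  have h1 : ∀ x, R.faceOf x = f → ∃ a, loc a = f ∧
      (P x (Sum.inr a)).symp (P (R.faceNext x) (Sum.inr a)) = 1 := by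
    intro x hx
    obtain ⟨a, ha, ha'⟩ := (hf x hx).exists_aux
    rw [R.faceOf_rot, SimpleGraph.Dart.symm_symm, hx] at ha
    rw [h.symm] at ha'
    exact ⟨a, ha, ha'⟩
  obtain ⟨a, ha, -⟩ := h1 d hd
  refine ⟨a, ha, fun x hx => ?_⟩
  obtain ⟨b, hb, hb'⟩ := h1 x hx
  rwa [hinj (ha.trans hb.symm)]

/-- On a simple face, sides that are not consecutive have no common vertex, so their operators
commute, and on the auxiliary qubit both are nontrivial. -/
theorem aux_eq_of_paired_face {f : R.Face} (h : IsEdgeStrings R loc P) (hs : R.IsSimpleFace f) {a : A}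
    (ha : ∀ x, R.faceOf x = f → (P x (Sum.inr a)).symp (P (R.faceNext x) (Sum.inr a)) = 1)
    {x y : G.Dart} (hx : R.faceOf x = f) (hy : R.faceOf y = f) (h1 : x ≠ y)
    (h2 : R.faceNext x ≠ y) (h3 : R.faceNext y ≠ x) : P x (Sum.inr a) = P y (Sum.inr a) := by
  have hx' : R.faceOf (R.faceNext x) = f := by rw [R.faceOf_faceNext, hx]
  have hy' : R.faceOf (R.faceNext y) = f := by rw [R.faceOf_faceNext, hy]
  refine h.aux_eq_of_disjoint ?_ ?_ ?_ ?_ (Pauli.ne_I_left_of_symp (ha x hx))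
    (Pauli.ne_I_left_of_symp (ha y hy))
  · exact fun e => h1 (hs x y hx hy e)
  · rw [← R.faceNext_fst y]
    exact fun e => h3 (hs _ _ hy' hx e.symm)
  · rw [← R.faceNext_fst x]
    exact fun e => h2 (hs _ _ hx' hy e)
  · rw [← R.faceNext_fst y, ← R.faceNext_fst x]
    exact fun e => h1 (R.faceNext.injective (hs _ _ hx' hy' e))

theorem minimalPeriod_of_paired_face {f : R.Face} (h : IsEdgeStrings R loc P) (hinj : Function.Injective loc)
    (hs : ∀ a, R.IsSimpleFace (loc a))
    (hf : ∀ x, R.faceOf x = f → IsPairedCorner R loc P x.symm) {d : G.Dart} (hd : R.faceOf d = f) :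
    Function.minimalPeriod R.faceNext d = 3 ∨ Function.minimalPeriod R.faceNext d = 4 := by
  obtain ⟨a, rfl, ha⟩ := h.exists_aux_of_paired_face hinj hf hd
  have hF : ∀ {x}, R.faceOf x = loc a → R.faceOf (R.faceNext x) = loc a := fun hx => by
    rw [R.faceOf_faceNext, hx]
  have h2 := (hf d hd).faceNext_faceNext_ne
  by_cases h3 : R.faceNext (R.faceNext (R.faceNext d)) = d
  · exact Or.inl (Function.minimalPeriod_eq_prime h3 (R.faceNext_ne d))
  by_cases h4 : R.faceNext (R.faceNext (R.faceNext (R.faceNext d))) = d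
  · exact Or.inr (Function.minimalPeriod_eq_prime_pow (p := 2) (k := 1) h2 h4)
  exfalso
  -- With five or more sides, sides 2 and 3 (counted from 0) both agree with side 0 on the auxiliary
  -- qubit, although they anticommute there.
  have e2 := h.aux_eq_of_paired_face (hs a) ha hd (hF (hF hd)) h2.symm (R.faceNext_ne _).symm h3
  have e3 := h.aux_eq_of_paired_face (hs a) ha hd (hF (hF (hF hd))) (Ne.symm h3)
    (fun e => h2 (R.faceNext.injective e).symm) h4
  have := ha _ (hF (hF hd))
  rw [← e2, ← e3, Pauli.symp_self] at this
  exact zero_ne_one this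

variable [Fintype G.Dart]

-- An edge lies in the boundary of a set of faces when the values on its two sides differ, which is
-- the coefficient `s d + s d.symm`. Triviality at `v` forces an even number of boundary edges for
-- each letter separately, since the vectors of `X` and `Y` are independent.
open Classical in
theorem sum_letter_eq_zero (h : IsEdgeStrings R loc P) {s : G.Dart → ZMod 2} {v : V}
    (hv : ∑ d, s d • (P d (Sum.inl v)).vec = 0) {ℓ : Pauli} (hℓ : ℓ = Pauli.X ∨ ℓ = Pauli.Y) :
    ∑ d : G.Dart, (if d.fst = v ∧ P d (Sum.inl v) = ℓ then s d + s d.symm else 0) = 0 := by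
  have h1 : ∑ d : G.Dart, (if d.fst = v then (s d + s d.symm) • (P d (Sum.inl v)).vec else 0) = 0 := by
    have h2 : ∑ d : G.Dart, (if d.fst = v then s d.symm • (P d (Sum.inl v)).vec else 0) =
        ∑ d : G.Dart, (if d.snd = v then s d • (P d (Sum.inl v)).vec else 0) := by
      rw [← Equiv.sum_comp
        (Function.Involutive.toPerm SimpleGraph.Dart.symm SimpleGraph.Dart.symm_involutive)]
      refine Finset.sum_congr rfl fun d _ => ?_
      rw [Function.Involutive.coe_toPerm, SimpleGraph.Dart.symm_symm, h.symm]
      rfl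
    have h3 : ∀ d : G.Dart, (if d.fst = v then (s d + s d.symm) • (P d (Sum.inl v)).vec else 0) =
        (if d.fst = v then s d • (P d (Sum.inl v)).vec else 0) +
          (if d.fst = v then s d.symm • (P d (Sum.inl v)).vec else 0) := by
      intro d
      split_ifs
      · rw [add_smul]
      · rw [add_zero]
    rw [Finset.sum_congr rfl fun d _ => h3 d, Finset.sum_add_distrib, h2, ← Finset.sum_add_distrib]
    refine (Finset.sum_congr rfl fun d _ => ?_).trans hv
    by_cases h4 : d.fst = v
    · rw [if_pos h4, if_neg (fun h5 => d.fst_ne_snd (h4.trans h5.symm)), add_zero]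
    · by_cases h5 : d.snd = v
      · rw [if_neg h4, if_pos h5, zero_add]
      · rw [if_neg h4, if_neg h5, add_zero,
            Pauli.vec_eq_zero_iff.2 (h.vertex_eq_I d v (Ne.symm h4) (Ne.symm h5)), smul_zero]
  -- A functional that is `1` on the letter `ℓ` and `0` on the other one of `X` and `Y`.
  obtain ⟨g, hg⟩ : ∃ g : ZMod 2 × ZMod 2 →ₗ[ZMod 2] ZMod 2, ∀ p : Pauli,
      p = Pauli.X ∨ p = Pauli.Y → g p.vec = if p = ℓ then 1 else 0 := by
    rcases hℓ with rfl | rfl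
    · refine ⟨LinearMap.fst _ _ _ + LinearMap.snd _ _ _, ?_⟩
      rintro p (rfl | rfl) <;> simp [Pauli.vec, CharTwo.add_self_eq_zero]
    · refine ⟨LinearMap.snd _ _ _, ?_⟩
      rintro p (rfl | rfl) <;> simp [Pauli.vec]
  have h2 := congrArg g h1
  rw [map_sum, map_zero] at h2
  refine (Finset.sum_congr rfl fun d _ => ?_).trans h2
  by_cases h3 : d.fst = v
  · subst h3
    rw [if_pos rfl, map_smul, hg _ (h.fst_eq d)]
    by_cases h4 : P d (Sum.inl d.fst) = ℓ <;> simp [h4]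
  · simp [h3]

/-- An edge that belongs to no paired corner at its first end point is not in a set of edges on
which the encoding is trivial. -/
theorem eq_symm_of_not_paired (h : IsEdgeStrings R loc P) (hs : ∀ a, R.IsSimpleFace (loc a))
    {s : G.Dart → ZMod 2} (hv : ∀ v, ∑ d, s d • (P d (Sum.inl v)).vec = 0) {d : G.Dart}
    (hd : ¬ IsPairedCorner R loc P d) (hd' : ∀ x, R.rot x = d → ¬ IsPairedCorner R loc P x) :
    s d = s d.symm := by
  classical
  have h1 := h.sum_letter_eq_zero (hv d.fst) (h.fst_eq d)
  rw [Finset.sum_eq_single d, if_pos ⟨rfl, rfl⟩] at h1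
  · exact CharTwo.add_eq_zero.1 h1
  · intro x _ hx
    refine if_neg ?_
    rintro ⟨h2, h3⟩
    rcases h.paired_of_letter_eq hs h2.symm hx.symm h3.symm with h4 | h4
    · exact hd h4.1
    · exact hd' x h4.2 h4.1
  · simp

theorem eq_symm_of_paired (h : IsEdgeStrings R loc P) (hs : ∀ a, R.IsSimpleFace (loc a))
    {s : G.Dart → ZMod 2} (hv : ∀ v, ∑ d, s d • (P d (Sum.inl v)).vec = 0) {d : G.Dart}
    (hd : IsPairedCorner R loc P d) :
    s d + s d.symm + (s (R.rot d) + s (R.rot d).symm) = 0 := by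
  classical
  have h1 := h.sum_letter_eq_zero (hv d.fst) (h.fst_eq d)
  rw [Finset.sum_eq_add d (R.rot d) hd.rot_ne.symm, if_pos ⟨rfl, rfl⟩,
    if_pos ⟨R.rot_fst d, hd.letter_eq.symm⟩] at h1
  · exact h1
  · intro x _ hx
    refine if_neg ?_
    rintro ⟨h2, h3⟩
    rcases h.paired_of_letter_eq hs h2.symm hx.1.symm h3.symm with h4 | h4
    · exact hx.2 h4.2.symm
    · exact h.not_paired_rot hs h4.1 (h4.2.symm ▸ hd)
  · simp
  · simp

open Classical in
/-- The value of a set of faces at the unpaired corner at or after `d`. -/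
noncomputable def cornerValue (R : RotationSystem G) (loc : A → R.Face)
    (P : G.Dart → V ⊕ A → Pauli) (s : R.Face → ZMod 2) (d : G.Dart) : ZMod 2 :=
  if IsPairedCorner R loc P d then s (R.faceOf (R.rot d).symm) else s (R.faceOf d.symm)

/-- The value of `s` does not change across an edge outside the paired corners, and the changes
across the two edges of a paired corner cancel. -/
theorem cornerValue_rot (h : IsEdgeStrings R loc P) (hs : ∀ a, R.IsSimpleFace (loc a))
    {s : R.Face → ZMod 2} (hv : ∀ v, ∑ d, s (R.faceOf d) • (P d (Sum.inl v)).vec = 0)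
    (d : G.Dart) : cornerValue R loc P s (R.rot d) = cornerValue R loc P s d := by
  by_cases hd : IsPairedCorner R loc P d
  · rw [cornerValue, cornerValue, if_pos hd, if_neg (h.not_paired_rot hs hd)]
  by_cases hd' : IsPairedCorner R loc P (R.rot d)
  · rw [cornerValue, cornerValue, if_neg hd, if_pos hd']
    have h1 := h.eq_symm_of_paired hs (s := fun d => s (R.faceOf d)) hv hd'
    simp only [R.faceOf_rot (R.rot d)] at h1
    rw [add_assoc, ← add_assoc (s (R.faceOf (R.rot d).symm)), CharTwo.add_self_eq_zero,
      zero_add] at h1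
    rw [← R.faceOf_rot d]
    exact (CharTwo.add_eq_zero.1 h1).symm
  · rw [cornerValue, cornerValue, if_neg hd, if_neg hd', ← R.faceOf_rot d]
    refine (h.eq_symm_of_not_paired hs (s := fun d => s (R.faceOf d)) hv hd' ?_).symm
    intro x hx
    rwa [R.rot.injective hx]

/-- On each side of the edge lie two corners, one at either end. If both corners on one side are
unpaired, they belong to one face and the values agree. A paired corner on each side would make the
edge act on the auxiliary qubits of both faces. Then these faces coincide, and simplicity forces
`R.rot` to fix both darts of the edge, against the genuineness of a paired corner. -/
theorem cornerValue_symm (h : IsEdgeStrings R loc P) (hs : ∀ a, R.IsSimpleFace (loc a))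
    {s : R.Face → ZMod 2} (hv : ∀ v, ∑ d, s (R.faceOf d) • (P d (Sum.inl v)).vec = 0)
    (d : G.Dart) : cornerValue R loc P s d.symm = cornerValue R loc P s d := by
  obtain ⟨e, he⟩ := R.rot.surjective d
  obtain ⟨e', he'⟩ := R.rot.surjective d.symm
  have he1 := h.cornerValue_rot hs hv e
  have he1' := h.cornerValue_rot hs hv e'
  rw [he] at he1
  rw [he'] at he1'
  by_cases h1 : ¬ IsPairedCorner R loc P d ∧ ¬ IsPairedCorner R loc P e'
  · rw [he1', cornerValue, cornerValue, if_neg h1.1, if_neg h1.2, ← R.faceOf_rot, he']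
  by_cases h2 : ¬ IsPairedCorner R loc P e ∧ ¬ IsPairedCorner R loc P d.symm
  · rw [he1, cornerValue, cornerValue, if_neg h2.1, if_neg h2.2, ← R.faceOf_rot e, he,
      SimpleGraph.Dart.symm_symm]
  exfalso
  have key : ∀ d e' : G.Dart, R.rot e' = d.symm →
      IsPairedCorner R loc P d ∨ IsPairedCorner R loc P e' →
      (R.rot d ≠ d ∨ R.rot d.symm ≠ d.symm) ∧
        ∃ a, loc a = R.faceOf d.symm ∧ P d (Sum.inr a) ≠ Pauli.I := by
    rintro d e' he' (hp | hp)
    · obtain ⟨a, ha, ha'⟩ := hp.exists_aux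
      exact ⟨Or.inl hp.rot_ne, a, by rw [ha, R.faceOf_rot], Pauli.ne_I_left_of_symp ha'⟩
    · obtain ⟨a, ha, ha'⟩ := hp.exists_aux
      rw [he'] at ha ha'
      refine ⟨Or.inr fun h3 => hp.rot_ne ?_, a, ha, ?_⟩
      · rw [R.rot.injective (he'.trans h3.symm)]
        exact h3
      · rw [← h.symm d]
        exact Pauli.ne_I_right_of_symp ha'
  rw [← not_or, not_not] at h1 h2
  obtain ⟨hne, a, ha, ha'⟩ := key d e' he' h1
  obtain ⟨-, b, hb, hb'⟩ := key d.symm e (by rw [he, SimpleGraph.Dart.symm_symm]) h2.symm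
  rw [h.symm] at hb'
  rw [SimpleGraph.Dart.symm_symm] at hb
  obtain rfl := h.aux_unique d a b ha' hb'
  rcases hne with hne | hne
  · exact hne (hs a _ _ (by rw [R.faceOf_rot, ha]) hb.symm (R.rot_fst d))
  · exact hne (hs a _ _ (by rw [R.faceOf_rot, SimpleGraph.Dart.symm_symm, hb]) ha.symm
      (R.rot_fst d.symm))

/-- If the encoding is trivial, on the vertex qubits, on the boundary of a set of bounded faces, then
all corners of these faces are paired. -/
theorem paired_of_ne_zero {E : PlaneEmbedding G} {loc : A → E.Face}
    (h : IsEdgeStrings E.toRotationSystem loc P) (hG : G.Connected)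
    (hs : ∀ a, E.IsSimpleFace (loc a)) (hb : ∀ a, loc a ≠ E.outer) {s : E.Face → ZMod 2}
    (hv : ∀ v, ∑ d, s (E.faceOf d) • (P d (Sum.inl v)).vec = 0) (ho : s E.outer = 0) {d : G.Dart}
    (hd : s (E.faceOf d) ≠ 0) : IsPairedCorner E.toRotationSystem loc P d.symm := by
  by_contra hp
  obtain ⟨x, hx⟩ := E.exists_faceOf_eq_outer hG d
  obtain ⟨y, rfl⟩ := E.rot.surjective x
  -- The outer face carries no auxiliary qubit, so its corners are unpaired and the constant corner
  -- value is `s E.outer = 0`.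
  have h1 : ¬ IsPairedCorner E.toRotationSystem loc P y := by
    intro hy
    obtain ⟨a, ha, -⟩ := hy.exists_aux
    exact hb a (ha.trans hx)
  have h2 := E.eq_of_invariant hG (h.cornerValue_rot hs hv) (h.cornerValue_symm hs hv) d.symm y
  rw [cornerValue, cornerValue, if_neg hp, if_neg h1, SimpleGraph.Dart.symm_symm, ← E.faceOf_rot,
    hx, ho] at h2
  exact hd h2

/-- The two sides that meet at a vertex of the face have the same letter there and cancel. On the
auxiliary qubit of the face the letters are `X`, `Y`, `Z` in some order, or two letters alternating.
No side acts on any other auxiliary qubit. -/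
theorem sum_vec_of_paired_face {f : R.Face} (h : IsEdgeStrings R loc P) (hinj : Function.Injective loc)
    (hs : ∀ a, R.IsSimpleFace (loc a))
    (hf : ∀ x, R.faceOf x = f → IsPairedCorner R loc P x.symm) {d : G.Dart} (hd : R.faceOf d = f)
    (q : V ⊕ A) : ((R.boundaryFrom d).map fun x => (P x q).vec).sum = 0 := by
  classical
  rcases q with v | b
  · rw [R.sum_boundaryFrom, hd]
    have h1 : ∀ x, (if R.faceOf x = f then (P x (Sum.inl v)).vec else 0) =
        (if R.faceOf x = f ∧ x.fst = v then (P x (Sum.inl v)).vec else 0) +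
        (if R.faceOf x = f ∧ x.snd = v then (P x (Sum.inl v)).vec else 0) := by
      intro x
      by_cases hx : R.faceOf x = f
      · by_cases h4 : x.fst = v
        · rw [if_pos hx, if_pos ⟨hx, h4⟩, if_neg (fun h5 => x.fst_ne_snd (h4.trans h5.2.symm)),
            add_zero]
        · by_cases h5 : x.snd = v
          · rw [if_pos hx, if_neg (fun h6 => h4 h6.2), if_pos ⟨hx, h5⟩, zero_add]
          · rw [if_pos hx, if_neg (fun h6 => h4 h6.2), if_neg (fun h6 => h5 h6.2), add_zero,
              h.vertex_eq_I x v (Ne.symm h4) (Ne.symm h5)]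
            rfl
      · rw [if_neg hx, if_neg (fun h6 => hx h6.1), if_neg (fun h6 => hx h6.1), add_zero]
    have h2 : ∑ x, (if R.faceOf x = f ∧ x.fst = v then (P x (Sum.inl v)).vec else 0) =
        ∑ x, (if R.faceOf x = f ∧ x.snd = v then (P x (Sum.inl v)).vec else 0) := by
      rw [← Equiv.sum_comp R.faceNext]
      refine Finset.sum_congr rfl fun x _ => ?_
      rw [R.faceOf_faceNext, R.faceNext_fst]
      split_ifs with hx
      · obtain ⟨hx, rfl⟩ := hx
        have := (hf x hx).letter_eq
        rw [h.symm] at this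
        exact congrArg Pauli.vec this.symm
      · rfl
    rw [Finset.sum_congr rfl fun x _ => h1 x, Finset.sum_add_distrib, h2]
    exact Prod.ext (CharTwo.add_self_eq_zero _) (CharTwo.add_self_eq_zero _)
  · obtain ⟨a, rfl, ha⟩ := h.exists_aux_of_paired_face hinj hf hd
    by_cases hb : b = a
    · subst hb
      have hF : ∀ {x}, R.faceOf x = loc b → R.faceOf (R.faceNext x) = loc b := fun hx => by
        rw [R.faceOf_faceNext, hx]
      have e0 := ha _ hd
      have e1 := ha _ (hF hd)
      have e2 := ha _ (hF (hF hd))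
      have hp := Function.iterate_minimalPeriod (f := R.faceNext) (x := d)
      rcases h.minimalPeriod_of_paired_face hinj hs hf hd with h3 | h3
      · rw [h3] at hp
        simp only [Function.iterate_succ, Function.iterate_zero, Function.comp_apply, id] at hp
        rw [hp] at e2
        rw [RotationSystem.boundaryFrom, h3]
        simp only [List.iterate, List.map_cons, List.map_nil, List.sum_cons, List.sum_nil, add_zero]
        exact Pauli.vec_add_vec_add_vec e0 e1 e2
      · have h2 : ∀ {x}, R.faceOf x = loc b → R.faceNext (R.faceNext x) ≠ x := fun hx =>
          (hf _ hx).faceNext_faceNext_ne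
        rw [h3] at hp
        simp only [Function.iterate_succ, Function.iterate_zero, Function.comp_apply, id] at hp
        have e02 := h.aux_eq_of_paired_face (hs b) ha hd (hF (hF hd)) (h2 hd).symm
          (R.faceNext_ne _).symm (fun e => R.faceNext_ne d (by rw [e] at hp; exact hp))
        have e13 := h.aux_eq_of_paired_face (hs b) ha (hF hd) (hF (hF (hF hd))) (h2 (hF hd)).symm
          (R.faceNext_ne _).symm (by rw [hp]; exact (R.faceNext_ne d).symm)
        rw [RotationSystem.boundaryFrom, h3]
        simp only [List.iterate, List.map_cons, List.map_nil, List.sum_cons, List.sum_nil, add_zero,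
          ← e02, ← e13]
        generalize (P d (Sum.inr b)).vec = p
        generalize (P (R.faceNext d) (Sum.inr b)).vec = p'
        revert p p'
        decide
    · apply List.sum_eq_zero
      intro y hy
      obtain ⟨x, hx, rfl⟩ := List.mem_map.1 hy
      rw [R.mem_boundaryFrom, hd] at hx
      rw [Pauli.vec_eq_zero_iff]
      by_contra hb'
      exact hb (h.aux_unique x b a hb' (Pauli.ne_I_left_of_symp (ha x hx)))

end IsEdgeStrings

/-! ### Fermionic encodings and their kernels -/

section EdgeSetVec

variable {V Q : Type*} {G : SimpleGraph V}

/-- The symplectic vector, at the qubit `q`, of the operators of a set of edges. -/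
noncomputable def edgeSetVec [Fintype G.edgeSet] (P : G.edgeSet → Q → Pauli) (q : Q) :
    (G.edgeSet → ZMod 2) →ₗ[ZMod 2] ZMod 2 × ZMod 2 :=
  Fintype.linearCombination (ZMod 2) fun e => (P e q).vec

theorem edgeSetVec_dartVec [Fintype G.edgeSet] (P : G.edgeSet → Q → Pauli) (q : Q) (d : G.Dart) :
    edgeSetVec P q (dartVec d) = (P (dartEdge d) q).vec := by
  classical
  rw [edgeSetVec, dartVec, Fintype.linearCombination_apply_single, one_smul]

end EdgeSetVec

namespace IsFermionicEncoding

variable {V Q : Type*} [Fintype Q] [DecidableEq Q] {G : SimpleGraph V} {σ : EVGroup G →* QubitOp Q}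

theorem map_phase_two (hσ : IsFermionicEncoding σ) : σ (EVGroup.phase G 2) = -1 := by
  rw [hσ.map_phase, show (2 : ZMod 4).val = 2 from rfl, Complex.I_sq, neg_one_smul]

/-- Such an element is a phase. The phase `-1` is excluded from the cycle group because `σ` maps it
to `-1`, and `±i` are excluded because their squares are `-1`. -/
theorem eq_one_of_edgeClass_eq_one (hσ : IsFermionicEncoding σ) {c : EVGroup G}
    (hc : c ∈ EVGroup.cycleGroup G) (h : EVGroup.edgeClass c = 1) : c = 1 := by
  obtain ⟨k, l, rfl⟩ := EVGroup.exists_eq_phase_mul_prod hc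
  have hl : (l.map dartVec).sum = 0 := by
    have h' := congrArg Multiplicative.toAdd h
    rwa [map_mul, toAdd_mul, EVGroup.edgeClass_phase, EVGroup.edgeClass_prod, zero_add] at h'
  obtain ⟨j, hj⟩ := EVGroup.exists_prod_eq_phase l hl
  rw [hj, EVGroup.phase_mul] at hc ⊢
  generalize k + j = m at hc
  have h2 : EVGroup.phase G 2 ∉ EVGroup.cycleGroup G := fun h =>
    hσ.map_cycle_ne _ h hσ.map_phase_two
  have hm : ∀ m : ZMod 4, m = 0 ∨ m = 2 ∨ m + m = 2 := by decide
  rcases hm m with rfl | rfl | hm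
  · exact EVGroup.phase_zero
  · exact absurd hc h2
  · have := mul_mem hc hc
    rw [EVGroup.phase_mul, hm] at this
    exact absurd this h2

theorem eq_of_edgeClass_eq (hσ : IsFermionicEncoding σ) {c c' : EVGroup G}
    (hc : c ∈ EVGroup.cycleGroup G) (hc' : c' ∈ EVGroup.cycleGroup G)
    (h : (EVGroup.edgeClass c).toAdd = (EVGroup.edgeClass c').toAdd) : c = c' := by
  rw [← mul_inv_eq_one]
  refine hσ.eq_one_of_edgeClass_eq_one (mul_mem hc (inv_mem hc')) ?_
  rw [map_mul, map_inv, mul_inv_eq_one]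
  exact h

theorem exists_map_prod_eq {P : G.edgeSet → Q → Pauli}
    (hP : ∀ d, ∃ k : ℕ, σ (EVGroup.edge G d) = Complex.I ^ k • pauliString (P (dartEdge d)))
    (l : List G.Dart) : ∃ (k : ℕ) (p : Q → Pauli),
      σ (l.map (EVGroup.edge G)).prod = Complex.I ^ k • pauliString p ∧
      ∀ q, (p q).vec = (l.map fun d => (P (dartEdge d) q).vec).sum := by
  induction l with
  | nil =>
    refine ⟨0, fun _ => Pauli.I, ?_, fun q => rfl⟩
    rw [List.map_nil, List.prod_nil, map_one, pow_zero, one_smul, pauliString_I]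
  | cons d l ih =>
    obtain ⟨k, p, hk, hp⟩ := ih
    obtain ⟨j, hj⟩ := hP d
    obtain ⟨m, p', hm, hp'⟩ := pauliString_mul (P (dartEdge d)) p
    refine ⟨j + k + m, p', ?_, ?_⟩
    · rw [List.map_cons, List.prod_cons, map_mul, hj, hk, Matrix.smul_mul, Matrix.mul_smul, hm,
        smul_smul, smul_smul, pow_add, pow_add]
    · intro q
      rw [hp', List.map_cons, List.sum_cons, hp]

/-- If the string is trivial, `σ c` is a fourth root of unity; it is not `-1`, and it is not `±i`
because `c * c` does not map to `-1` either. -/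
theorem map_eq_one_iff [Fintype G.edgeSet] (hσ : IsFermionicEncoding σ)
    {P : G.edgeSet → Q → Pauli}
    (hP : ∀ d, ∃ k : ℕ, σ (EVGroup.edge G d) = Complex.I ^ k • pauliString (P (dartEdge d)))
    {c : EVGroup G} (hc : c ∈ EVGroup.cycleGroup G) :
    σ c = 1 ↔ ∀ q, edgeSetVec P q (EVGroup.edgeClass c).toAdd = 0 := by
  obtain ⟨k, p, hk, hp⟩ : ∃ (k : ℕ) (p : Q → Pauli), σ c = Complex.I ^ k • pauliString p ∧
      ∀ q, (p q).vec = edgeSetVec P q (EVGroup.edgeClass c).toAdd := by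
    obtain ⟨j, l, rfl⟩ := EVGroup.exists_eq_phase_mul_prod hc
    obtain ⟨k, p, hk, hp⟩ := exists_map_prod_eq hP l
    refine ⟨j.val + k, p, ?_, fun q => ?_⟩
    · rw [map_mul, hσ.map_phase, hk, Matrix.smul_mul, one_mul, smul_smul, pow_add]
    · rw [hp, map_mul, toAdd_mul, EVGroup.edgeClass_phase, EVGroup.edgeClass_prod, zero_add,
        map_list_sum, List.map_map]
      congr 2
      funext d
      exact (edgeSetVec_dartVec P q d).symm
  simp only [← hp, Pauli.vec_eq_zero_iff]
  constructor
  · intro h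
    exact eq_I_of_smul_pauliString_eq_one (hk.symm.trans h)
  · intro h
    rw [show p = fun _ => Pauli.I from funext h, pauliString_I] at hk
    have h4 : (Complex.I ^ k * Complex.I ^ k) * (Complex.I ^ k * Complex.I ^ k) = 1 := by
      rw [← pow_add, ← pow_add, show k + k + (k + k) = 4 * k by ring, pow_mul, Complex.I_pow_four,
        one_pow]
    rcases mul_self_eq_one_iff.1 h4 with h2 | h2
    · rcases mul_self_eq_one_iff.1 h2 with h1 | h1
      · rw [hk, h1, one_smul]
      · exact absurd (by rw [hk, h1, neg_one_smul]) (hσ.map_cycle_ne c hc)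
    · refine absurd ?_ (hσ.map_cycle_ne (c * c) (mul_mem hc hc))
      rw [map_mul, hk, Matrix.smul_mul, one_mul, smul_smul, h2, neg_one_smul]

end IsFermionicEncoding

/-! ### Generation and minimality for weight three planar encodings -/

namespace IsWeightThreePlanarEncoding

variable {V A : Type*} [Fintype V] [DecidableEq V] [Fintype A] [DecidableEq A] {G : SimpleGraph V}
  {E : PlaneEmbedding G} {loc : A → E.Face} {σ : EVGroup G →* QubitOp (V ⊕ A)}

theorem exists_edgeStrings (hσ : IsWeightThreePlanarEncoding E loc σ) :
    ∃ P : G.edgeSet → V ⊕ A → Pauli,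
      (∀ d, ∃ k : ℕ, σ (EVGroup.edge G d) = Complex.I ^ k • pauliString (P (dartEdge d))) ∧
      IsEdgeStrings E.toRotationSystem loc fun d => P (dartEdge d) := by
  -- The two darts of an edge differ by a sign, so the string of one chosen dart serves for both.
  obtain ⟨r, hr⟩ := (dartEdge_surjective (G := G)).hasRightInverse
  choose k P h1 h2 h3 h4 h5 h6 using hσ.edge_op
  have hrd : ∀ d, r (dartEdge d) = d ∨ r (dartEdge d) = d.symm := fun d =>
    dartEdge_eq_iff.1 (hr (dartEdge d))
  have hP : ∀ d, ∃ j : ℕ, σ (EVGroup.edge G d) =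
      Complex.I ^ j • pauliString (P (r (dartEdge d))) := by
    intro d
    rcases hrd d with h | h <;> rw [h]
    · exact ⟨_, h1 d⟩
    · refine ⟨2 + k d.symm, ?_⟩
      rw [EVGroup.edge_eq_symm d, map_mul, h1, hσ.map_phase_two, pow_add, Complex.I_sq,
        mul_smul, neg_one_smul, neg_one_mul]
  refine ⟨fun e => P (r e), hP, ⟨fun d => by rw [dartEdge_symm], fun d => ?_, fun d v hv hv' => ?_,
    fun d a ha => ?_, fun d a b => h6 _ a b, fun d d' e1 e2 e3 e4 => ?_, fun d d' hd hne => ?_⟩⟩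
  · beta_reduce
    rcases hrd d with h | h <;> rw [h]
    · exact h2 d
    · exact h3 d.symm
  · beta_reduce
    rcases hrd d with h | h <;> rw [h]
    · exact h4 d v hv hv'
    · exact h4 d.symm v hv' hv
  · rcases hrd d with h | h
    · have := h5 _ a ha
      rwa [h] at this
    · have := h5 _ a ha
      rw [h, RotationSystem.Adjacent, SimpleGraph.Dart.symm_symm] at this
      exact this.symm
  · obtain ⟨j, hj⟩ := hP d
    obtain ⟨j', hj'⟩ := hP d'
    refine symp_sum_of_smul_mul (pow_ne_zero j Complex.I_ne_zero) (pow_ne_zero j' Complex.I_ne_zero)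
      _ _ 0 ?_
    rw [← hj, ← hj', ← map_mul, ← map_mul, EVGroup.edge_comm e1 e2 e3 e4]
    exact (one_smul ℂ _).symm
  · obtain ⟨j, hj⟩ := hP d.symm
    obtain ⟨j', hj'⟩ := hP d'
    rw [dartEdge_symm] at hj
    refine symp_sum_of_smul_mul (pow_ne_zero j Complex.I_ne_zero) (pow_ne_zero j' Complex.I_ne_zero)
      _ _ 1 ?_
    rw [← hj, ← hj', ← map_mul, ← map_mul, EVGroup.edge_anticomm (d := d.symm) (d' := d') hd
      (fun h => hne (SimpleGraph.Dart.ext _ _ (Prod.ext hd h))), map_mul, hσ.map_phase_two,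
      show (1 : ZMod 2).val = 1 from rfl, pow_one, neg_one_smul, neg_one_mul]

variable {P : G.edgeSet → V ⊕ A → Pauli}

/-- Only triviality on the vertex qubits is used here. -/
theorem paired_of_mem_kernel [Fintype G.Dart] (hσ : IsWeightThreePlanarEncoding E loc σ)
    (hG : G.Connected) (hsimple : ∀ a, E.IsSimpleFace (loc a))
    (hP : ∀ d, ∃ k : ℕ, σ (EVGroup.edge G d) = Complex.I ^ k • pauliString (P (dartEdge d)))
    (hE : IsEdgeStrings E.toRotationSystem loc fun d => P (dartEdge d))
    {c : EVGroup.cycleGroup G} (hc : c ∈ encodingKernel σ) {s : E.Face → ZMod 2}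
    (ho : s E.outer = 0) (hs : E.bdry s = (EVGroup.edgeClass (c : EVGroup G)).toAdd) {f : E.Face}
    (hf : s f ≠ 0) (d : G.Dart) (hd : E.faceOf d = f) :
    IsPairedCorner E.toRotationSystem loc (fun d => P (dartEdge d)) d.symm := by
  have := Fintype.ofFinite G.edgeSet
  refine hE.paired_of_ne_zero hG hsimple hσ.loc_bounded (s := s) (fun v => ?_) ho (hd ▸ hf)
  have h := (hσ.toIsFermionicEncoding.map_eq_one_iff hP c.2).1 hc (Sum.inl v)
  rw [← hs, RotationSystem.bdry_apply, map_sum] at h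
  rw [← h]
  refine Finset.sum_congr rfl fun d _ => ?_
  rw [map_smul, edgeSetVec_dartVec]

theorem faceCycle_mem_kernel [Fintype G.Dart] (hσ : IsWeightThreePlanarEncoding E loc σ)
    (hsimple : ∀ a, E.IsSimpleFace (loc a))
    (hP : ∀ d, ∃ k : ℕ, σ (EVGroup.edge G d) = Complex.I ^ k • pauliString (P (dartEdge d)))
    (hE : IsEdgeStrings E.toRotationSystem loc fun d => P (dartEdge d)) {d : G.Dart}
    (hf : ∀ x, E.faceOf x = E.faceOf d →
      IsPairedCorner E.toRotationSystem loc (fun d => P (dartEdge d)) x.symm) :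
    (⟨_, E.loopElement_boundaryFrom_mem d⟩ : EVGroup.cycleGroup G) ∈ encodingKernel σ := by
  have := Fintype.ofFinite G.edgeSet
  refine (hσ.toIsFermionicEncoding.map_eq_one_iff hP (E.loopElement_boundaryFrom_mem d)).2 fun q => ?_
  rw [EVGroup.edgeClass_loopElement, map_list_sum, List.map_map,
    ← hE.sum_vec_of_paired_face hσ.loc_injective hsimple hf rfl q]
  congr 2
  funext x
  exact edgeSetVec_dartVec P q x

open Classical in
theorem exists_face_of_mem_kernelFaceCycles [Fintype G.Dart] {c : EVGroup.cycleGroup G}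
    (hc : c ∈ kernelFaceCycles E σ) : ∃ f : E.Face, f ≠ E.outer ∧
      E.bdry (Pi.single f 1) = (EVGroup.edgeClass (c : EVGroup G)).toAdd := by
  obtain ⟨-, f, hf, d, rfl, hd⟩ := hc
  exact ⟨_, hf, by rw [hd, E.edgeClass_loopElement_boundaryFrom]⟩

/-- A linear relation would be a set of bounded faces with zero boundary, hence empty. Different
elements belong to different faces because the edge class is injective on the cycle group. -/
theorem linearIndependent_kernelFaceCycles [Fintype G.Dart] (hG : G.Connected)
    (hσ : IsWeightThreePlanarEncoding E loc σ) :
    LinearIndependent (ZMod 2) fun c : kernelFaceCycles E σ =>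
      (EVGroup.edgeClass (c : EVGroup G)).toAdd := by
  classical
  choose f hf hfc using fun c : kernelFaceCycles E σ => exists_face_of_mem_kernelFaceCycles c.2
  have hinj : Function.Injective f := by
    intro c c' h
    refine Subtype.ext (Subtype.ext (hσ.toIsFermionicEncoding.eq_of_edgeClass_eq c.1.2 c'.1.2 ?_))
    rw [← hfc, ← hfc, h]
  have : Finite E.Face := by unfold RotationSystem.Face; infer_instance
  have := Finite.of_injective f hinj
  have := Fintype.ofFinite (kernelFaceCycles E σ)
  rw [Fintype.linearIndependent_iff]
  intro g hg c
  have h1 : ∑ c, g c • (Pi.single (f c) 1 : E.Face → ZMod 2) = 0 := by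
    refine E.eq_zero_of_bdry_eq_zero hG ?_ ?_
    · rw [Finset.sum_apply]
      refine Finset.sum_eq_zero fun c _ => ?_
      rw [Pi.smul_apply, Pi.single_eq_of_ne (hf c).symm, smul_zero]
    · simpa only [map_sum, map_smul, hfc] using hg
  have h2 := congrFun h1 (f c)
  rw [Finset.sum_apply, Finset.sum_eq_single c] at h2
  · simpa using h2
  · intro b _ hb
    rw [Pi.smul_apply, Pi.single_eq_of_ne (fun h => hb (hinj h).symm), smul_zero]
  · simp

/-- The edge classes of any generating set span those of the face cycles, which are independent. -/
theorem encard_kernelFaceCycles_le (hG : G.Connected) (hσ : IsWeightThreePlanarEncoding E loc σ)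
    {T : Set (EVGroup.cycleGroup G)} (hT : Subgroup.closure T = encodingKernel σ) :
    (kernelFaceCycles E σ).encard ≤ T.encard := by
  classical
  have := SimpleGraph.Dart.finite G
  have := Fintype.ofFinite G.Dart
  rcases T.finite_or_infinite with hfin | hinf
  swap
  · rw [hinf.encard_eq]
    exact le_top
  have hLI := linearIndependent_kernelFaceCycles hG hσ
  have := Finite.of_injective _ hLI.injective
  have := Fintype.ofFinite (kernelFaceCycles E σ)
  set φ : EVGroup.cycleGroup G → (G.edgeSet → ZMod 2) := fun c =>
    (EVGroup.edgeClass (c : EVGroup G)).toAdd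
  have hle : Submodule.span (ZMod 2) (Set.range fun c : kernelFaceCycles E σ => φ c) ≤
      Submodule.span (ZMod 2) (hfin.toFinset.image φ : Set (G.edgeSet → ZMod 2)) := by
    rw [Submodule.span_le]
    rintro _ ⟨⟨c, hc⟩, rfl⟩
    have hcT : c ∈ Subgroup.closure T := hT ▸ hc.1
    change φ c ∈ Submodule.span (ZMod 2) (hfin.toFinset.image φ : Set (G.edgeSet → ZMod 2))
    clear hc
    induction hcT using Subgroup.closure_induction with
    | mem x hx => exact Submodule.subset_span (by simpa using ⟨x, x.2, hx, rfl⟩)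
    | one => simp [φ]
    | mul x y _ _ hx hy =>
      have : φ (x * y) = φ x + φ y := by simp [φ]
      simpa only [this] using add_mem hx hy
    | inv x _ hx =>
      have : φ x⁻¹ = - φ x := by simp [φ]
      simpa only [this] using neg_mem hx
  have h1 := Submodule.finrank_mono hle
  rw [finrank_span_eq_card hLI] at h1
  have h2 := h1.trans ((finrank_span_finset_le_card _).trans Finset.card_image_le)
  rw [hfin.encard_eq_coe_toFinset_card, Set.encard_eq_coe_toFinset_card, Set.toFinset_card]
  exact_mod_cast h2

theorem closure_kernelFaceCycles (hG : G.Connected) (hσ : IsWeightThreePlanarEncoding E loc σ)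
    (hsimple : ∀ a, E.IsSimpleFace (loc a)) :
    Subgroup.closure (kernelFaceCycles E σ) = encodingKernel σ := by
  classical
  have := SimpleGraph.Dart.finite G
  have := Fintype.ofFinite G.Dart
  have : Finite E.Face := by unfold RotationSystem.Face; infer_instance
  have := Fintype.ofFinite E.Face
  refine le_antisymm ((Subgroup.closure_le _).2 fun c hc => hc.1) fun c hc => ?_
  obtain ⟨P, hP, hE⟩ := hσ.exists_edgeStrings
  obtain ⟨s, ho, hs⟩ := E.exists_bdry_eq hG (vertexBdry_edgeClass c.2)
  -- Each face of `s` contributes its own face cycle, already in the kernel; their product has the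
  -- edge class of `c` and is therefore `c`.
  obtain ⟨c', hc', h⟩ : ∃ c' ∈ Subgroup.closure (kernelFaceCycles E σ),
      (EVGroup.edgeClass (c' : EVGroup G)).toAdd = E.bdry s := by
    rw [← Finset.univ_sum_single s, map_sum]
    refine Finset.sum_induction _ (fun y => ∃ c' ∈ Subgroup.closure (kernelFaceCycles E σ),
      (EVGroup.edgeClass (c' : EVGroup G)).toAdd = y) ?_ ⟨1, one_mem _, by simp⟩ fun f _ => ?_
    · rintro _ _ ⟨c, hc, rfl⟩ ⟨c', hc', rfl⟩
      exact ⟨c * c', mul_mem hc hc', by simp⟩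
    · by_cases hf : s f = 0
      · exact ⟨1, one_mem _, by simp [hf]⟩
      · have hfo : f ≠ E.outer := fun h => hf (h ▸ ho)
        obtain ⟨d, rfl⟩ := E.exists_faceOf_of_ne_outer hG hfo
        have hfull := hσ.paired_of_mem_kernel hG hsimple hP hE hc ho hs hf
        refine ⟨⟨_, E.loopElement_boundaryFrom_mem d⟩, Subgroup.subset_closure
          ⟨hσ.faceCycle_mem_kernel hsimple hP hE hfull, _, hfo, d, rfl, rfl⟩, ?_⟩
        have h01 : ∀ x : ZMod 2, x ≠ 0 → x = 1 := by decide
        rw [h01 _ hf, E.edgeClass_loopElement_boundaryFrom]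
  rwa [Subtype.ext (hσ.toIsFermionicEncoding.eq_of_edgeClass_eq c.2 c'.2 (hs.symm.trans h.symm))]

theorem sides_of_mem_kernel (hG : G.Connected) (hσ : IsWeightThreePlanarEncoding E loc σ)
    (hsimple : ∀ a, E.IsSimpleFace (loc a)) {f : E.Face} (hf : f ≠ E.outer)
    {c : EVGroup.cycleGroup G} (hc : c ∈ encodingKernel σ) (hcf : E.IsFaceCycle f (c : EVGroup G)) :
    E.sides f = 3 ∨ E.sides f = 4 := by
  classical
  have := SimpleGraph.Dart.finite G
  have := Fintype.ofFinite G.Dart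
  obtain ⟨P, hP, hE⟩ := hσ.exists_edgeStrings
  obtain ⟨d, rfl, hcd⟩ := hcf
  rw [E.sides_faceOf]
  refine hE.minimalPeriod_of_paired_face hσ.loc_injective hsimple
    (hσ.paired_of_mem_kernel hG hsimple hP hE hc (s := Pi.single (E.faceOf d) 1) ?_ ?_ ?_) rfl
  · exact Pi.single_eq_of_ne hf.symm 1
  · rw [hcd, E.edgeClass_loopElement_boundaryFrom]
  · rw [Pi.single_eq_same]
    exact one_ne_zero

end IsWeightThreePlanarEncoding

theorem mainTheorem4 {V A : Type*} [Fintype V] [DecidableEq V] [Fintype A] [DecidableEq A]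
    (G : SimpleGraph V) (hG : G.Connected) (E : PlaneEmbedding G) (loc : A → E.Face)
    (σ : EVGroup G →* QubitOp (V ⊕ A)) (hσ : IsWeightThreePlanarEncoding E loc σ)
    (hsimple : ∀ a, E.IsSimpleFace (loc a)) :
    -- the face cycles in the kernel generate it
    Subgroup.closure (kernelFaceCycles E σ) = encodingKernel σ ∧
    -- none of them can be left out
    (∀ T : Set (EVGroup.cycleGroup G), T ⊂ kernelFaceCycles E σ →
      Subgroup.closure T ≠ encodingKernel σ) ∧
    -- and no generating set of the kernel has fewer elements
    (∀ T : Set (EVGroup.cycleGroup G), Subgroup.closure T = encodingKernel σ →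
      (kernelFaceCycles E σ).encard ≤ T.encard) ∧
    -- the face cycles in the kernel are around faces with three or four sides
    (∀ f : E.Face, f ≠ E.outer → ∀ c ∈ encodingKernel σ, E.IsFaceCycle f (c : EVGroup G) →
      E.sides f = 3 ∨ E.sides f = 4) := by
  refine ⟨hσ.closure_kernelFaceCycles hG hsimple, fun T hT hcl => ?_,
    fun T hT => hσ.encard_kernelFaceCycles_le hG hT,
    fun f hf c hc hcf => hσ.sides_of_mem_kernel hG hsimple hf hc hcf⟩
  have := SimpleGraph.Dart.finite G
  have := Fintype.ofFinite G.Dart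
  have hfin : (kernelFaceCycles E σ).Finite :=
    Finite.of_injective _ (hσ.linearIndependent_kernelFaceCycles hG).injective
  -- Irredundancy follows from the cardinality bound, since the set is finite.
  exact ((hfin.subset hT.subset).encard_lt_encard hT).not_ge (hσ.encard_kernelFaceCycles_le hG hcl)
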